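/- Let $r\ge 0$ be an integer and let $\mathrm{Par}$ be the set of all partitions (including the empty one); write $\ell(\lambda)$ for the number of (nonzero) parts of $\lambda$ and $\mathrm{rev}(\lambda)$ for its parts listed in weakly increasing order. Let $\Lambda(X)$ be the ring of symmetric functions over $\mathbb{Q}$ in the variables $X=\{x_1,x_2,\ldots\}$, i.e. formal power series of bounded degree over $\mathbb{Q}$ that are invariant under all permutations of the variables, and let $$\Lambda(X_1|\cdots|X_r):=\Lambda(X_1)\otimes_{\mathbb{Q}}\cdots\otimes_{\mathbb{Q}}\Lambda(X_r),\qquad X_i=\{x_{i,1},x_{i,2},\ldots\},$$ be the ring of $r$ multi-symmetric functions. For $n\ge 0$ the key polynomials $\mathcal{K}_\alpha\in\mathbb{Q}[x_1,\ldots,x_n]$, $\alpha\in\mathbb{Z}_{\ge 0}^n$, are the unique family of polynomials such that $\mathcal{K}_\alpha=x^\alpha$ whenever $\alpha_1\ge\cdots\ge\alpha_n$, and, whenever $1\le i\le n-1$ and $\alpha_i>\alpha_{i+1}$, $$\mathcal{K}_{s_i(\alpha)}=\xi_i(\mathcal{K}_\alpha),\qquad \xi_i(f):=\frac{x_i f-x_{i+1}s_i(f)}{x_i-x_{i+1}},$$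 where $s_i$ exchanges the $i$-th and $(i+1)$-st entries, respectively variables. For $\lambda=(\lambda^{(1)}|\cdots|\lambda^{(r)})\in\mathrm{Par}^r$ and $n_i\ge\ell(\lambda^{(i)})$ put $$\mathcal{S}^{(n_1|\cdots|n_r)}_{\lambda}:=\mathcal{K}_{(0^{n_1-\ell(\lambda^{(1)})}*\mathrm{rev}(\lambda^{(1)}))*\cdots*(0^{n_r-\ell(\lambda^{(r)})}*\mathrm{rev}(\lambda^{(r)}))}(x_{1,1},\ldots,x_{1,n_1},\ldots,x_{r,1},\ldots,x_{r,n_r}),$$ where $*$ denotes concatenation, and let the multi-symmetric Schur function be $$\mathcal{S}_\lambda(X_1|\cdots|X_r):=\lim_{n_1,\ldots,n_r\to\infty}\mathcal{S}^{(n_1|\cdots|n_r)}_{\lambda},$$ the limit being that of formal power series (the coefficient of each monomial is eventually constant). Then the canonical map sending $f_1\otimes\cdots\otimes f_r$ to the formal power series $f_1(X_1)\cdots f_r(X_r)$ in the variables $x_{i,j}$ is injective on $\Lambda(X_1|\cdots|X_r)$; with $\Lambda(X_1|\cdots|X_r)$ identified with its image, all the limits $\mathcal{S}_\lambda$ exist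 and lie in $\Lambda(X_1|\cdots|X_r)$, and the family $(\mathcal{S}_\lambda)_{\lambda\in\mathrm{Par}^r}$ is a $\mathbb{Q}$-basis of $\Lambda(X_1|\cdots|X_r)$. -/

import Mathlib

open scoped TensorProduct

noncomputable section

namespace MultiSymm

open MvPolynomial

/-! ### Isobaric divided difference operators -/

/-- Interchange of the variables `X i` and `X j`. -/
def swapVars {σ : Type*} [DecidableEq σ] (i j : σ) : MvPolynomial σ ℚ →ₐ[ℚ] MvPolynomial σ ℚ :=
  rename (Equiv.swap i j)

theorem sub_dvd_isobaric {σ : Type*} [DecidableEq σ] (i j : σ) (f : MvPolynomial σ ℚ) :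
    (X i - X j : MvPolynomial σ ℚ) ∣ X i * f - X j * swapVars i j f := by
  have key : ∀ f : MvPolynomial σ ℚ, (X i - X j : MvPolynomial σ ℚ) ∣ f - swapVars i j f := by
    intro f
    have h : (Ideal.Quotient.mkₐ ℚ (Ideal.span {(X i - X j : MvPolynomial σ ℚ)})).comp
        (swapVars i j) = Ideal.Quotient.mkₐ ℚ (Ideal.span {(X i - X j : MvPolynomial σ ℚ)}) := by
      apply MvPolynomial.algHom_ext
      intro k
      have hij : Ideal.Quotient.mk (Ideal.span {(X i - X j : MvPolynomial σ ℚ)}) (X i) =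
          Ideal.Quotient.mk _ (X j) :=
        Ideal.Quotient.eq.2 (Ideal.mem_span_singleton_self _)
      simp only [AlgHom.comp_apply, swapVars, rename_X, Ideal.Quotient.mkₐ_eq_mk]
      by_cases hi : k = i
      · subst hi; simp [hij]
      · by_cases hj : k = j
        · subst hj; simp [hij]
        · rw [Equiv.swap_apply_of_ne_of_ne hi hj]
    have h2 := DFunLike.congr_fun h f
    rw [← Ideal.mem_span_singleton]
    exact Ideal.Quotient.eq.1 h2.symm
  have : X i * f - X j * swapVars i j f = (X i - X j) * f + X j * (f - swapVars i j f) := by ring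
  rw [this]
  exact dvd_add (dvd_mul_right _ _) ((key f).mul_left _)

/-- The isobaric divided difference `(x_i f - x_j s_{ij} f) / (x_i - x_j)` for `i ≠ j`
(the exact quotient of polynomials). -/
def isobaric {σ : Type*} [DecidableEq σ] (i j : σ) (f : MvPolynomial σ ℚ) : MvPolynomial σ ℚ :=
  (sub_dvd_isobaric i j f).choose

theorem isobaric_spec {σ : Type*} [DecidableEq σ] (i j : σ) (f : MvPolynomial σ ℚ) :
    (X i - X j) * isobaric i j f = X i * f - X j * swapVars i j f :=
  (sub_dvd_isobaric i j f).choose_spec.symm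

/-! ### Key polynomials -/

/-- The two defining properties of the family of key polynomials in `n` variables. -/
structure IsKeyFamily {n : ℕ} (K : (Fin n → ℕ) → MvPolynomial (Fin n) ℚ) : Prop where
  dominant : ∀ a : Fin n → ℕ, Antitone a → K a = ∏ k, X k ^ a k
  step : ∀ (a : Fin n → ℕ) (i j : Fin n), (j : ℕ) = i + 1 → a j < a i →
    K (a ∘ Equiv.swap i j) = isobaric i j (K a)

theorem weight_swap_lt {n : ℕ} (a : Fin n → ℕ) (i j : Fin n) (hij : (j : ℕ) = i + 1)
    (h : a i < a j) :
    ∑ k : Fin n, (k : ℕ) * (a ∘ Equiv.swap i j) k < ∑ k : Fin n, (k : ℕ) * a k := by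
  have hne : j ≠ i := by intro h; rw [h] at hij; omega
  have split : ∀ b : Fin n → ℕ, ∑ k : Fin n, (k : ℕ) * b k =
      (i : ℕ) * b i + ((j : ℕ) * b j + ∑ k ∈ (Finset.univ.erase i).erase j, (k : ℕ) * b k) := by
    intro b
    rw [Finset.add_sum_erase _ (fun k : Fin n => (k : ℕ) * b k) (by simp [hne]),
      Finset.add_sum_erase _ (fun k : Fin n => (k : ℕ) * b k) (by simp)]
  rw [split, split a]
  have : ∑ k ∈ (Finset.univ.erase i).erase j, (k : ℕ) * (a ∘ Equiv.swap i j) k =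
      ∑ k ∈ (Finset.univ.erase i).erase j, (k : ℕ) * a k := by
    apply Finset.sum_congr rfl
    intro k hk
    simp only [Finset.mem_erase, Finset.mem_univ, and_true] at hk
    simp [Equiv.swap_apply_of_ne_of_ne hk.2 hk.1]
  rw [this]
  simp only [Function.comp, Equiv.swap_apply_left, Equiv.swap_apply_right, hij]
  nlinarith

open Classical in
/-- The key polynomial of `a`: the monomial `x^a` if `a` is weakly decreasing, and otherwise
`ξ_i (K_{s_i a})` for a position `i` with `a_i < a_{i+1}`. By `existsUnique_isKeyFamily` below
the choice of the position is immaterial. -/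
def keyPoly {n : ℕ} (a : Fin n → ℕ) : MvPolynomial (Fin n) ℚ :=
  if h : ∃ p : Fin n × Fin n, (p.2 : ℕ) = p.1 + 1 ∧ a p.1 < a p.2 then
    isobaric h.choose.1 h.choose.2 (keyPoly (a ∘ Equiv.swap h.choose.1 h.choose.2))
  else ∏ k, X k ^ a k
termination_by ∑ k : Fin n, (k : ℕ) * a k
decreasing_by exact weight_swap_lt a _ _ h.choose_spec.1 h.choose_spec.2

theorem isobaric_comm {σ : Type*} [DecidableEq σ] {i j k l : σ} (hij : i ≠ j) (hkl : k ≠ l)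
    (hik : i ≠ k) (hil : i ≠ l) (hjk : j ≠ k) (hjl : j ≠ l) (f : MvPolynomial σ ℚ) :
    isobaric i j (isobaric k l f) = isobaric k l (isobaric i j f) := by
  have e1 := isobaric_spec k l f
  have e2 := isobaric_spec i j (isobaric k l f)
  have e3 := congrArg (swapVars i j) e1
  have d1 := isobaric_spec i j f
  have d2 := isobaric_spec k l (isobaric i j f)
  have d3 := congrArg (swapVars k l) d1
  have hst : swapVars k l (swapVars i j f) = swapVars i j (swapVars k l f) := by
    simp only [swapVars, rename_rename]
    congr 2
    funext m
    simp only [Function.comp, Equiv.swap_apply_def]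
    grind
  simp only [map_mul, map_sub, hst] at e3 d3
  simp only [swapVars, rename_X] at e3 d3
  rw [Equiv.swap_apply_of_ne_of_ne hik.symm hjk.symm,
    Equiv.swap_apply_of_ne_of_ne hil.symm hjl.symm] at e3
  rw [Equiv.swap_apply_of_ne_of_ne hik hil, Equiv.swap_apply_of_ne_of_ne hjk hjl] at d3
  simp only [swapVars] at e1 e2 d1 d2
  have h1 : (X i - X j : MvPolynomial σ ℚ) ≠ 0 := sub_ne_zero.2 fun h => hij (X_injective h)
  have h2 : (X k - X l : MvPolynomial σ ℚ) ≠ 0 := sub_ne_zero.2 fun h => hkl (X_injective h)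
  apply mul_left_cancel₀ (mul_ne_zero h1 h2)
  linear_combination (X k - X l) * e2 + X i * e1 - X j * e3 - (X i - X j) * d2 - X k * d1 + X l * d3

theorem swapVars_isobaric {σ : Type*} [DecidableEq σ] {i j : σ} (hij : i ≠ j)
    (f : MvPolynomial σ ℚ) : swapVars i j (isobaric i j f) = isobaric i j f := by
  have e1 := isobaric_spec i j f
  have e2 := congrArg (swapVars i j) e1
  have hss : swapVars i j (swapVars i j f) = f := by
    have hc : (Equiv.swap i j : σ → σ) ∘ Equiv.swap i j = id := by
      funext m
      simp
    rw [swapVars, rename_rename, hc, rename_id_apply]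
  simp only [map_mul, map_sub, hss] at e2
  simp only [swapVars, rename_X, Equiv.swap_apply_left, Equiv.swap_apply_right] at e1 e2 ⊢
  have h1 : (X i - X j : MvPolynomial σ ℚ) ≠ 0 := sub_ne_zero.2 fun h => hij (X_injective h)
  apply mul_left_cancel₀ h1
  linear_combination -e2 - e1

theorem isobaric_braid {σ : Type*} [DecidableEq σ] {i j k : σ} (hij : i ≠ j) (hjk : j ≠ k)
    (hik : i ≠ k) (f : MvPolynomial σ ℚ) :
    isobaric i j (isobaric j k (isobaric i j f)) = isobaric j k (isobaric i j (isobaric j k f)) := by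
  have hb : swapVars j k (swapVars i j (swapVars j k f)) =
      swapVars i j (swapVars j k (swapVars i j f)) := by
    simp only [swapVars, rename_rename]
    congr 2
    funext m
    simp only [Function.comp, Equiv.swap_apply_def]
    grind
  have h1 : (X i - X j : MvPolynomial σ ℚ) ≠ 0 := sub_ne_zero.2 fun h => hij (X_injective h)
  have h2 : (X j - X k : MvPolynomial σ ℚ) ≠ 0 := sub_ne_zero.2 fun h => hjk (X_injective h)
  have h3 : (X i - X k : MvPolynomial σ ℚ) ≠ 0 := sub_ne_zero.2 fun h => hik (X_injective h)
  have si : swapVars i j (X i) = X j := by simp [swapVars]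
  have sj : swapVars i j (X j) = X i := by simp [swapVars]
  have sk : swapVars i j (X k) = X k := by
    simp [swapVars, Equiv.swap_apply_of_ne_of_ne hik.symm hjk.symm]
  have ti : swapVars j k (X i) = X i := by
    simp [swapVars, Equiv.swap_apply_of_ne_of_ne hij hik]
  have tj : swapVars j k (X j) = X k := by simp [swapVars]
  have tk : swapVars j k (X k) = X j := by simp [swapVars]
  have a1 := isobaric_spec i j f
  have a2 := isobaric_spec j k (isobaric i j f)
  have a3 := isobaric_spec i j (isobaric j k (isobaric i j f))
  have a4 := congrArg (swapVars j k) a1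
  have a5 := congrArg (swapVars i j) a2
  have a6 := congrArg (swapVars i j) a4
  have b1 := isobaric_spec j k f
  have b2 := isobaric_spec i j (isobaric j k f)
  have b3 := isobaric_spec j k (isobaric i j (isobaric j k f))
  have b4 := congrArg (swapVars i j) b1
  have b5 := congrArg (swapVars j k) b2
  have b6 := congrArg (swapVars j k) b4
  simp only [map_mul, map_sub, si, sj, sk, ti, tj, tk, swapVars_isobaric hij,
    swapVars_isobaric hjk, hb] at a4 a5 a6 b4 b5 b6
  apply mul_left_cancel₀ (mul_ne_zero (mul_ne_zero h1 h2) h3)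
  linear_combination (X j - X k) * (X i - X k) * a3 + X i * (X i - X k) * a2 -
    X j * (X j - X k) * a5 + X i * X j * a1 - X i * X k * a4 + X j * X k * a6 -
    ((X i - X j) * (X i - X k) * b3 + X j * (X i - X k) * b2 -
    X k * (X i - X j) * b5 + X i * X i * b1 - X j * X j * b4 + X k * X k * b6)

theorem keyPoly_of_ascent {n : ℕ} (N : ℕ) : ∀ a : Fin n → ℕ, ∑ k : Fin n, (k : ℕ) * a k = N →
    ∀ i j : Fin n, (j : ℕ) = i + 1 → a i < a j →
      keyPoly a = isobaric i j (keyPoly (a ∘ Equiv.swap i j)) := by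
  induction N using Nat.strong_induction_on with
  | _ N ih =>
    intro a ha
    -- the case of two adjacent ascents
    have braid : ∀ x y z : Fin n, (y : ℕ) = x + 1 → (z : ℕ) = y + 1 → a x < a y → a y < a z →
        isobaric x y (keyPoly (a ∘ Equiv.swap x y)) =
          isobaric y z (keyPoly (a ∘ Equiv.swap y z)) := by
      intro x y z hxy hyz h1 h2
      have nxy : x ≠ y := by rintro rfl; omega
      have nyz : y ≠ z := by rintro rfl; omega
      have nxz : x ≠ z := by rintro rfl; omega
      have sz : Equiv.swap x y z = z := Equiv.swap_apply_of_ne_of_ne nxz.symm nyz.symm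
      have tx : Equiv.swap y z x = x := Equiv.swap_apply_of_ne_of_ne nxy nxz
      have w1 := weight_swap_lt a x y hxy h1
      have w2 := weight_swap_lt a y z hyz h2
      have g1 : (a ∘ Equiv.swap x y) y < (a ∘ Equiv.swap x y) z := by
        simp [sz]; omega
      have g2 : (a ∘ Equiv.swap y z) x < (a ∘ Equiv.swap y z) y := by
        simp [tx]; omega
      have w3 := weight_swap_lt _ y z hyz g1
      have w4 := weight_swap_lt _ x y hxy g2
      rw [ih _ (ha ▸ w1) (a ∘ Equiv.swap x y) rfl y z hyz g1,
        ih _ (ha ▸ w2) (a ∘ Equiv.swap y z) rfl x y hxy g2,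
        ih _ (ha ▸ (w3.trans w1)) ((a ∘ Equiv.swap x y) ∘ Equiv.swap y z) rfl x y hxy (by
          simpa [sz, tx] using h2),
        ih _ (ha ▸ (w4.trans w2)) ((a ∘ Equiv.swap y z) ∘ Equiv.swap x y) rfl y z hyz (by
          simpa [sz, tx] using h1),
        isobaric_braid nxy nyz nxz]
      congr 4
      funext m
      simp only [Function.comp, Equiv.swap_apply_def]
      grind
    intro i j hij hlt
    have h : ∃ p : Fin n × Fin n, (p.2 : ℕ) = p.1 + 1 ∧ a p.1 < a p.2 := ⟨(i, j), hij, hlt⟩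
    rw [keyPoly, dif_pos h]
    obtain ⟨hpq, hp⟩ := h.choose_spec
    generalize h.choose.1 = p at hpq hp ⊢
    generalize h.choose.2 = q at hpq hp ⊢
    by_cases e1 : p = i
    · subst e1
      have : q = j := Fin.ext (by omega)
      rw [this]
    have e1' : (p : ℕ) ≠ i := fun h => e1 (Fin.ext h)
    by_cases e2 : q = i
    · subst e2
      exact braid p q j hpq hij hp hlt
    by_cases e3 : j = p
    · subst e3
      exact (braid i j q hij hpq hlt hp).symm
    have e2' : (q : ℕ) ≠ i := fun h => e2 (Fin.ext h)
    have e3' : (j : ℕ) ≠ p := fun h => e3 (Fin.ext h)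
    have n1 : p ≠ q := by rintro rfl; omega
    have n2 : i ≠ j := by rintro rfl; omega
    have n3 : q ≠ j := by rintro rfl; omega
    rw [ih _ (ha ▸ weight_swap_lt a p q hpq hp) (a ∘ Equiv.swap p q) rfl i j hij (by
        simpa [Equiv.swap_apply_of_ne_of_ne (Ne.symm e1) (Ne.symm e2),
          Equiv.swap_apply_of_ne_of_ne e3 (Ne.symm n3)] using hlt),
      ih _ (ha ▸ weight_swap_lt a i j hij hlt) (a ∘ Equiv.swap i j) rfl p q hpq (by
        simpa [Equiv.swap_apply_of_ne_of_ne e1 (Ne.symm e3),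
          Equiv.swap_apply_of_ne_of_ne e2 n3] using hp),
      isobaric_comm n1 n2 e1 (Ne.symm e3) e2 n3]
    congr 3
    funext m
    simp only [Function.comp, Equiv.swap_apply_def]
    grind

theorem isKeyFamily_keyPoly (n : ℕ) : IsKeyFamily (keyPoly : (Fin n → ℕ) → _) where
  dominant a ha := by
    rw [keyPoly, dif_neg]
    rintro ⟨⟨p, q⟩, h1, h2⟩
    exact absurd (ha (show p ≤ q from Fin.le_def.2 (by simp only at h1; omega))) (not_le.2 h2)
  step a i j hij h := by
    rw [keyPoly_of_ascent _ (a ∘ Equiv.swap i j) rfl i j hij (by simpa using h)]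
    congr 2
    funext m
    simp

/-- The family `keyPoly` is the only one with the two defining properties of key polynomials. -/
theorem existsUnique_isKeyFamily (n : ℕ) :
    ∃! K : (Fin n → ℕ) → MvPolynomial (Fin n) ℚ, IsKeyFamily K := by
  refine ⟨keyPoly, isKeyFamily_keyPoly n, fun K hK => ?_⟩
  suffices H : ∀ N, ∀ a : Fin n → ℕ, ∑ k : Fin n, (k : ℕ) * a k = N → K a = keyPoly a from
    funext fun a => H _ a rfl
  intro N
  induction N using Nat.strong_induction_on with
  | _ N ih =>
    intro a ha
    by_cases h : ∃ i j : Fin n, (j : ℕ) = i + 1 ∧ a i < a j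
    · obtain ⟨i, j, hij, hlt⟩ := h
      have hk : a = (a ∘ Equiv.swap i j) ∘ Equiv.swap i j := by
        funext m
        simp
      rw [keyPoly_of_ascent _ a rfl i j hij hlt, ← ih _ (ha ▸ weight_swap_lt a i j hij hlt) _ rfl,
        ← hK.step _ i j hij (by simpa using hlt), ← hk]
    · push Not at h
      have hanti : Antitone a := by
        cases n with
        | zero => exact fun x => x.elim0
        | succ n => exact Fin.antitone_iff_succ_le.2 fun i => h i.castSucc i.succ (by simp)
      rw [hK.dominant a hanti, (isKeyFamily_keyPoly n).dominant a hanti]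

/-! ### Symmetric and multi-symmetric functions -/

/-- The ring `Λ(X)` of symmetric functions over `ℚ`: formal power series of bounded degree in
countably many variables that are invariant under all permutations of the variables. -/
def SymmFun : Subalgebra ℚ (MvPowerSeries ℕ ℚ) where
  carrier := {f | (∃ N : ℕ, ∀ d : ℕ →₀ ℕ, MvPowerSeries.coeff d f ≠ 0 → d.degree ≤ N) ∧
    ∀ s : Equiv.Perm ℕ, MvPowerSeries.rename s f = f}
  mul_mem' := by
    classical
    rintro f g ⟨⟨M, hM⟩, hf⟩ ⟨⟨N, hN⟩, hg⟩
    refine ⟨⟨M + N, fun d hd => ?_⟩, fun s => by rw [map_mul, hf, hg]⟩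
    rw [MvPowerSeries.coeff_mul] at hd
    obtain ⟨p, hp, hne⟩ := Finset.exists_ne_zero_of_sum_ne_zero hd
    rw [← Finset.HasAntidiagonal.mem_antidiagonal.1 hp, map_add]
    exact add_le_add (hM _ (left_ne_zero_of_mul hne)) (hN _ (right_ne_zero_of_mul hne))
  add_mem' := by
    rintro f g ⟨⟨M, hM⟩, hf⟩ ⟨⟨N, hN⟩, hg⟩
    refine ⟨⟨max M N, fun d hd => ?_⟩, fun s => by rw [map_add, hf, hg]⟩
    by_cases h : MvPowerSeries.coeff d f = 0
    · exact le_max_of_le_right (hN d (by simpa [h] using hd))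
    · exact le_max_of_le_left (hM d h)
  algebraMap_mem' c := by
    classical
    refine ⟨⟨0, fun d hd => ?_⟩, fun s => AlgHom.commutes _ c⟩
    rw [MvPowerSeries.algebraMap_apply, MvPowerSeries.coeff_C] at hd
    by_cases h : d = 0
    · simp [h]
    · simp [h] at hd

/-- The ring `Λ(X_1|⋯|X_r) = Λ(X_1) ⊗ ⋯ ⊗ Λ(X_r)` of `r` multi-symmetric functions. -/
abbrev MultiSymmFun (r : ℕ) : Type := ⨂[ℚ] _ : Fin r, SymmFun

instance tendstoCofinite_mk {r : ℕ} (i : Fin r) :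
    Filter.TendstoCofinite (Prod.mk i : ℕ → Fin r × ℕ) :=
  Filter.tendstoCofinite_of_injective (Prod.mk_right_injective i)

/-- The expansion of a multi-symmetric function as a formal power series in the variables
`x_{i,j}`: it sends `f_1 ⊗ ⋯ ⊗ f_r` to `f_1(X_1) ⋯ f_r(X_r)`. The variable `x_{i,j}` has index
`(i, j)`, both coordinates being counted from zero. -/
def expand (r : ℕ) : MultiSymmFun r →ₗ[ℚ] MvPowerSeries (Fin r × ℕ) ℚ :=
  PiTensorProduct.lift
    ((MultilinearMap.mkPiAlgebra ℚ (Fin r) (MvPowerSeries (Fin r × ℕ) ℚ)).compLinearMap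
      fun i => ((MvPowerSeries.rename (Prod.mk i)).comp SymmFun.val).toLinearMap)

/-! ### Multi-symmetric Schur functions -/

/-- The composition `(0^{n_1 - ℓ(λ^1)} * rev λ^1) * ⋯ * (0^{n_r - ℓ(λ^r)} * rev λ^r)` of length
`n_1 + ⋯ + n_r`, for `n_i ≥ ℓ(λ^i)`. A partition is a Young diagram, with parts its row lengths,
so that the entry in position `j` of the `i`-th block is the part of `λ^i` with (zero-based) index
`n_i - 1 - j`, which is zero if that index is at least `ℓ(λ^i)`. -/
def blockComposition {r : ℕ} (lam : Fin r → YoungDiagram) (n : Fin r → ℕ) :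
    Fin (∑ i, n i) → ℕ := fun k =>
  (lam (finSigmaFinEquiv.symm k).1).rowLen (finSigmaFinEquiv.symm k).2.rev

/-- The multi-symmetric Schur polynomial, i.e. the key polynomial of the block composition in the
variables `x_{1,1}, …, x_{1,n_1}, …, x_{r,1}, …, x_{r,n_r}`. -/
def multiSchurPoly {r : ℕ} (lam : Fin r → YoungDiagram) (n : Fin r → ℕ) :
    MvPolynomial (Fin r × ℕ) ℚ :=
  rename (fun k => ((finSigmaFinEquiv.symm k).1, ((finSigmaFinEquiv.symm k).2 : ℕ)))
    (keyPoly (blockComposition lam n))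

/-- `f` is the multi-symmetric Schur function of `lam`: its expansion is the limit of the
multi-symmetric Schur polynomials as `n_1, …, n_r → ∞`, i.e. each coefficient of these polynomials
is eventually equal to that of `f`. -/
def IsMultiSchurFun {r : ℕ} (lam : Fin r → YoungDiagram) (f : MultiSymmFun r) : Prop :=
  ∀ d : Fin r × ℕ →₀ ℕ, ∀ᶠ n : Fin r → ℕ in Filter.atTop,
    (multiSchurPoly lam n).coeff d = MvPowerSeries.coeff d (expand r f)

end MultiSymm

end

/-! Two properties of key polynomials carry the proof. First, if `a i ≤ a (i + 1)` then `keyPoly a`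
is symmetric in the variables `i` and `i + 1`; for equal entries the braid relation moves this
invariance past the ascents of `a`. Hence multi-symmetric Schur polynomials are symmetric in each
block of variables. Secondly, if `a u` is minimal among the entries up to `u`, then the lowest power
of `X u` in `keyPoly a` is the `a u`-th one, and its coefficient is the key polynomial of `a` with
`u` deleted. With `u = 0` this makes the key polynomials linearly independent, by induction on the
number of variables; with `a u = 0` it shows that a coefficient of a multi-symmetric Schur
polynomial does not change when variables absent from its monomial are dropped, so that the limits
exist.

In the basis of products of monomial symmetric functions, the coordinates of a multi-symmetric
function are coefficients of its expansion. So a multi-symmetric function is determined by its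
expansion, and every power series of bounded degree that is symmetric in each set of variables is
the expansion of one; in particular the limits are. They are linearly independent and homogeneous,
and the homogeneous parts are finite-dimensional, with dimension equal to the number of limits of
that degree; so the limits span. -/

noncomputable section

namespace MultiSymm

open MvPolynomial

/-! ### Isobaric divided differences -/

theorem isHomogeneous_of_mul {σ R : Type*} [CommRing R] [IsDomain R] {p q : MvPolynomial σ R}
    {m d : ℕ} (hp : p.IsHomogeneous m) (hp0 : p ≠ 0) (hpq : (p * q).IsHomogeneous (m + d)) :
    q.IsHomogeneous d := by
  let _ := gradedAlgebra (σ := σ) (R := R)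
  have h : (DirectSum.decompose (homogeneousSubmodule σ R) (p * q) (m + d) : MvPolynomial σ R) =
      p * DirectSum.decompose (homogeneousSubmodule σ R) q d :=
    DirectSum.coe_decompose_mul_add_of_left_mem _ hp
  rw [DirectSum.decompose_of_mem_same _ hpq] at h
  rw [mul_left_cancel₀ hp0 h]
  exact (DirectSum.decompose (homogeneousSubmodule σ R) q d).2

section Isobaric

variable {σ τ R : Type*} [CommRing R] [Nontrivial R] {i j : σ}

theorem X_sub_X_ne_zero (hij : i ≠ j) : (X i - X j : MvPolynomial σ R) ≠ 0 :=
  sub_ne_zero.2 (X_injective.ne hij)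

theorem not_X_dvd_X_sub_X (hij : i ≠ j) (u : σ) : ¬(X u : MvPolynomial σ R) ∣ X i - X j := by
  classical
  rintro ⟨q, hq⟩
  by_cases hu : u = i
  · have h := congrArg (eval (Pi.single j 1)) hq
    simp [hu, hij] at h
  · have h := congrArg (eval (Pi.single i 1)) hq
    simp [hu, hij.symm] at h

variable [DecidableEq σ] [DecidableEq τ]

theorem swapVars_X (i j k : σ) : swapVars i j (X k) = X (Equiv.swap i j k) :=
  rename_X _ _

theorem rename_swapVars {e : σ → τ} (he : Function.Injective e) (i j : σ)
    (f : MvPolynomial σ ℚ) :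
    rename e (swapVars i j f) = swapVars (e i) (e j) (rename e f) := by
  simp only [swapVars, rename_rename, he.swap_comp]

theorem isobaric_eq_iff (hij : i ≠ j) {f g : MvPolynomial σ ℚ} :
    isobaric i j f = g ↔ (X i - X j) * g = X i * f - X j * swapVars i j f := by
  rw [← isobaric_spec, mul_right_inj' (X_sub_X_ne_zero hij), eq_comm]

theorem isobaric_eq_self_iff (hij : i ≠ j) {f : MvPolynomial σ ℚ} :
    isobaric i j f = f ↔ swapVars i j f = f := by
  rw [isobaric_eq_iff hij, sub_mul, sub_right_inj, mul_right_inj' (X_ne_zero j), eq_comm]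

theorem isobaric_sub (hij : i ≠ j) (f g : MvPolynomial σ ℚ) :
    isobaric i j (f - g) = isobaric i j f - isobaric i j g := by
  rw [isobaric_eq_iff hij, mul_sub, isobaric_spec, isobaric_spec, map_sub]
  ring

theorem isobaric_mul_of_swapVars_eq (hij : i ≠ j) {g : MvPolynomial σ ℚ}
    (hg : swapVars i j g = g) (f : MvPolynomial σ ℚ) :
    isobaric i j (g * f) = g * isobaric i j f := by
  rw [isobaric_eq_iff hij, mul_left_comm, isobaric_spec, map_mul, hg]
  ring

theorem isobaric_X_pow_mul (hij : i ≠ j) {u : σ} (hi : u ≠ i) (hj : u ≠ j) (m : ℕ)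
    (f : MvPolynomial σ ℚ) : isobaric i j (X u ^ m * f) = X u ^ m * isobaric i j f :=
  isobaric_mul_of_swapVars_eq hij
    (by rw [map_pow, swapVars_X, Equiv.swap_apply_of_ne_of_ne hi hj]) f

theorem X_pow_succ_dvd_isobaric_sub (hij : i ≠ j) {m : ℕ} {f r : MvPolynomial σ ℚ}
    (hf : X i ^ m ∣ f) (hr : X i ^ m ∣ r) (hs : X i ^ (m + 1) ∣ swapVars i j f - r) :
    X i ^ (m + 1) ∣ isobaric i j f - r := by
  refine X_prime.pow_dvd_of_dvd_mul_left _ (not_X_dvd_X_sub_X hij i) ?_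
  have h : (X i - X j) * (isobaric i j f - r) =
      X i * f - X i * r - X j * (swapVars i j f - r) := by
    rw [mul_sub, isobaric_spec]
    ring
  rw [h]
  refine dvd_sub (dvd_sub ?_ ?_) (hs.mul_left _) <;> rw [pow_succ']
  exacts [mul_dvd_mul_left _ hf, mul_dvd_mul_left _ hr]

theorem rename_isobaric {e : σ → τ} (he : Function.Injective e) (hij : i ≠ j)
    (f : MvPolynomial σ ℚ) :
    rename e (isobaric i j f) = isobaric (e i) (e j) (rename e f) := by
  refine ((isobaric_eq_iff (he.ne hij)).2 ?_).symm
  simpa only [map_mul, map_sub, rename_X, rename_swapVars he] using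
    congrArg (rename e) (isobaric_spec i j f)

theorem isHomogeneous_isobaric (hij : i ≠ j) {f : MvPolynomial σ ℚ} {d : ℕ}
    (hf : f.IsHomogeneous d) : (isobaric i j f).IsHomogeneous d := by
  refine isHomogeneous_of_mul ((isHomogeneous_X ℚ i).sub (isHomogeneous_X ℚ j))
    (X_sub_X_ne_zero hij) ?_
  rw [isobaric_spec]
  exact ((isHomogeneous_X ℚ i).mul hf).sub ((isHomogeneous_X ℚ j).mul hf.rename_isHomogeneous)

end Isobaric

/-! ### Key polynomials -/

section KeyPoly

variable {n : ℕ} {a : Fin n → ℕ} {i j : Fin n}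

theorem ne_of_val_eq_succ (hij : (j : ℕ) = i + 1) : i ≠ j := by
  rintro rfl
  omega

theorem swap_apply_le_iff {u : Fin n} (hij : (j : ℕ) = i + 1) (hu : u ≠ i) (k : Fin n) :
    Equiv.swap i j k ≤ u ↔ k ≤ u := by
  rw [Equiv.swap_apply_def]
  grind

theorem le_comp_swap_apply {m : ℕ} (hij : (j : ℕ) = i + 1) (hle : a i ≤ a j)
    (h : ∀ k ≤ i, m ≤ a k) : ∀ k ≤ j, m ≤ (a ∘ Equiv.swap i j) k := by
  intro k hk
  rw [Function.comp_apply, Equiv.swap_apply_def]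
  grind

theorem keyPoly_of_antitone (ha : Antitone a) : keyPoly a = ∏ k, X k ^ a k :=
  (isKeyFamily_keyPoly n).dominant a ha

theorem keyPoly_eq_isobaric (hij : (j : ℕ) = i + 1) (hlt : a i < a j) :
    keyPoly a = isobaric i j (keyPoly (a ∘ Equiv.swap i j)) :=
  keyPoly_of_ascent _ a rfl i j hij hlt

theorem antitone_or_exists_ascent (a : Fin n → ℕ) :
    Antitone a ∨ ∃ i j : Fin n, (j : ℕ) = i + 1 ∧ a i < a j := by
  rw [or_iff_not_imp_right]
  intro h
  push Not at h
  cases n with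
  | zero => exact fun x => x.elim0
  | succ n => exact Fin.antitone_iff_succ_le.2 fun i => h i.castSucc i.succ (by simp)

theorem composition_induction {P : (Fin n → ℕ) → Prop} (antitone : ∀ a, Antitone a → P a)
    (ascent : ∀ (a : Fin n → ℕ) (i j : Fin n), (j : ℕ) = i + 1 → a i < a j →
      P (a ∘ Equiv.swap i j) → P a) (a : Fin n → ℕ) : P a := by
  obtain ha | ⟨i, j, hij, hlt⟩ := antitone_or_exists_ascent a
  · exact antitone a ha
  · exact ascent a i j hij hlt (composition_induction antitone ascent _)
termination_by ∑ k : Fin n, (k : ℕ) * a k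
decreasing_by exact weight_swap_lt a i j hij hlt

theorem isHomogeneous_keyPoly (a : Fin n → ℕ) : (keyPoly a).IsHomogeneous (∑ k, a k) := by
  induction a using composition_induction with
  | antitone a ha =>
    rw [keyPoly_of_antitone ha]
    exact IsHomogeneous.prod _ _ _ fun k _ => isHomogeneous_X_pow k (a k)
  | ascent a i j hij hlt ih =>
    rw [keyPoly_eq_isobaric hij hlt, ← Equiv.sum_comp (Equiv.swap i j) a]
    exact isHomogeneous_isobaric (ne_of_val_eq_succ hij) ih

theorem swapVars_prod_X_pow (h : a i = a j) :
    swapVars i j (∏ k, X k ^ a k) = ∏ k, X k ^ a k := by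
  have ha : ∀ k, a (Equiv.swap i j k) = a k := fun k => by
    rw [Equiv.swap_apply_def]
    split_ifs <;> simp_all
  simp only [map_prod, map_pow, swapVars_X]
  rw [← Equiv.prod_comp (Equiv.swap i j) fun k => (X k : MvPolynomial (Fin n) ℚ) ^ a k]
  simp only [ha]

theorem isobaric_keyPoly_of_eq_of_ascent_left {p q j : Fin n} (hpq : (q : ℕ) = p + 1)
    (hqj : (j : ℕ) = q + 1) (hlt : a p < a q) (h : a q = a j)
    (ih : ∀ b : Fin n → ℕ, ∑ k : Fin n, (k : ℕ) * b k < ∑ k : Fin n, (k : ℕ) * a k →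
      b p = b q → isobaric p q (keyPoly b) = keyPoly b) :
    isobaric q j (keyPoly a) = keyPoly a := by
  have hne := ne_of_val_eq_succ hpq
  have hne' := ne_of_val_eq_succ hqj
  have hpj : p ≠ j := by
    rintro rfl
    omega
  have hlt' : (a ∘ Equiv.swap p q) q < (a ∘ Equiv.swap p q) j := by
    simpa [Equiv.swap_apply_of_ne_of_ne hpj.symm hne'.symm, ← h] using hlt
  have hbraid := ih ((a ∘ Equiv.swap p q) ∘ Equiv.swap q j)
    ((weight_swap_lt _ q j hqj hlt').trans (weight_swap_lt a p q hpq hlt))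
    (by simp [Equiv.swap_apply_of_ne_of_ne hpj.symm hne'.symm,
      Equiv.swap_apply_of_ne_of_ne hne hpj, h])
  rw [keyPoly_eq_isobaric hpq hlt, keyPoly_eq_isobaric hqj hlt', ← isobaric_braid hne hne' hpj,
    hbraid]

theorem isobaric_keyPoly_of_eq_of_ascent_right {i p q : Fin n} (hip : (p : ℕ) = i + 1)
    (hpq : (q : ℕ) = p + 1) (h : a i = a p) (hlt : a p < a q)
    (ih : ∀ b : Fin n → ℕ, ∑ k : Fin n, (k : ℕ) * b k < ∑ k : Fin n, (k : ℕ) * a k →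
      b p = b q → isobaric p q (keyPoly b) = keyPoly b) :
    isobaric i p (keyPoly a) = keyPoly a := by
  have hne := ne_of_val_eq_succ hip
  have hne' := ne_of_val_eq_succ hpq
  have hiq : i ≠ q := by
    rintro rfl
    omega
  have hlt' : (a ∘ Equiv.swap p q) i < (a ∘ Equiv.swap p q) p := by
    simpa [Equiv.swap_apply_of_ne_of_ne hne hiq, h] using hlt
  have hbraid := ih ((a ∘ Equiv.swap p q) ∘ Equiv.swap i p)
    ((weight_swap_lt _ i p hip hlt').trans (weight_swap_lt a p q hpq hlt))
    (by simp [Equiv.swap_apply_of_ne_of_ne hne hiq,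
      Equiv.swap_apply_of_ne_of_ne hiq.symm hne'.symm, h])
  rw [keyPoly_eq_isobaric hpq hlt, keyPoly_eq_isobaric hip hlt', isobaric_braid hne hne' hiq,
    hbraid]

theorem isobaric_keyPoly_of_eq (a : Fin n → ℕ) {i j : Fin n} (hij : (j : ℕ) = i + 1)
    (h : a i = a j) : isobaric i j (keyPoly a) = keyPoly a := by
  have hne := ne_of_val_eq_succ hij
  obtain ha | ⟨p, q, hpq, hlt⟩ := antitone_or_exists_ascent a
  · rw [isobaric_eq_self_iff hne, keyPoly_of_antitone ha, swapVars_prod_X_pow h]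
  by_cases hqi : q = i
  · subst hqi
    exact isobaric_keyPoly_of_eq_of_ascent_left hpq hij hlt h
      fun b _ => isobaric_keyPoly_of_eq b hpq
  by_cases hpj : p = j
  · subst hpj
    exact isobaric_keyPoly_of_eq_of_ascent_right hij hpq h hlt
      fun b _ => isobaric_keyPoly_of_eq b hpq
  · have hpi : p ≠ i := by
      rintro rfl
      rw [Fin.ext (hij.trans hpq.symm)] at h
      omega
    have hqj : q ≠ j := by
      rintro rfl
      exact hpi (Fin.ext (by omega))
    have := weight_swap_lt a p q hpq hlt
    have ih := isobaric_keyPoly_of_eq (a ∘ Equiv.swap p q) hij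
      (by simp [Equiv.swap_apply_of_ne_of_ne hpi.symm (Ne.symm hqi),
        Equiv.swap_apply_of_ne_of_ne (Ne.symm hpj) hqj.symm, h])
    rw [keyPoly_eq_isobaric hpq hlt, isobaric_comm hne (ne_of_val_eq_succ hpq) hpi.symm
      (Ne.symm hqi) (Ne.symm hpj) hqj.symm, ih]
termination_by ∑ k : Fin n, (k : ℕ) * a k
decreasing_by all_goals omega

theorem swapVars_keyPoly_of_le (hij : (j : ℕ) = i + 1) (h : a i ≤ a j) :
    swapVars i j (keyPoly a) = keyPoly a := by
  obtain hlt | heq := h.lt_or_eq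
  · rw [keyPoly_eq_isobaric hij hlt, swapVars_isobaric (ne_of_val_eq_succ hij)]
  · exact (isobaric_eq_self_iff (ne_of_val_eq_succ hij)).1 (isobaric_keyPoly_of_eq a hij heq)

/-! ### Lowest-order terms of key polynomials -/

theorem X_pow_dvd_keyPoly {m : ℕ} {u : Fin n} (h : ∀ k ≤ u, m ≤ a k) :
    X u ^ m ∣ keyPoly a := by
  induction a using composition_induction generalizing u with
  | antitone a ha =>
    rw [keyPoly_of_antitone ha]
    exact (pow_dvd_pow _ (h u le_rfl)).trans (Finset.dvd_prod_of_mem _ (Finset.mem_univ u))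
  | ascent a i j hij hlt ih =>
    have hne := ne_of_val_eq_succ hij
    rw [keyPoly_eq_isobaric hij hlt]
    by_cases hu : u ≠ i ∧ u ≠ j
    · obtain ⟨g, hg⟩ := ih fun k hk => h _ ((swap_apply_le_iff hij hu.1 k).2 hk)
      rw [hg, isobaric_X_pow_mul hne hu.1 hu.2]
      exact dvd_mul_right _ _
    · have hle := le_comp_swap_apply hij hlt.le fun k hk => h k (by grind)
      have huj : Equiv.swap i j u ≤ j ∧ u ≤ j := by
        rw [Equiv.swap_apply_def]
        grind
      have hswap : X u ^ m ∣ swapVars i j (keyPoly (a ∘ Equiv.swap i j)) := by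
        have := map_dvd (swapVars i j) (ih fun k hk => hle k (hk.trans huj.1))
        rwa [map_pow, swapVars_X, Equiv.swap_apply_self] at this
      refine X_prime.pow_dvd_of_dvd_mul_left m (not_X_dvd_X_sub_X hne u) ?_
      rw [isobaric_spec]
      exact dvd_sub ((ih fun k hk => hle k (hk.trans huj.2)).mul_left _) (hswap.mul_left _)

theorem swap_comp_succAbove {i j : Fin (n + 1)} (hij : (j : ℕ) = i + 1) :
    Equiv.swap i j ∘ j.succAbove = i.succAbove := by
  funext k
  rw [Function.comp_apply, Equiv.swap_apply_def]
  simp only [Fin.succAbove, Fin.lt_def, Fin.ext_iff]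
  grind

theorem val_eq_succ_of_succAbove {u : Fin (n + 1)}
    (h : (u.succAbove j : ℕ) = u.succAbove i + 1) : (j : ℕ) = i + 1 := by
  simp only [Fin.succAbove, Fin.lt_def] at h
  grind

theorem X_pow_succ_dvd_keyPoly_sub {a : Fin (n + 1) → ℕ} {u : Fin (n + 1)}
    (h : ∀ k ≤ u, a u ≤ a k) :
    X u ^ (a u + 1) ∣
      keyPoly a - X u ^ a u * rename u.succAbove (keyPoly (a ∘ u.succAbove)) := by
  induction a using composition_induction generalizing u with
  | antitone a ha =>
    rw [keyPoly_of_antitone ha,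
      keyPoly_of_antitone (ha.comp_monotone u.strictMono_succAbove.monotone),
      Fin.prod_univ_succAbove _ u]
    simp
  | ascent a i j hij hlt ih =>
    have hne := ne_of_val_eq_succ hij
    have hju : j ≠ u := by
      rintro rfl
      exact (h i (by grind)).not_gt hlt
    rw [keyPoly_eq_isobaric hij hlt]
    by_cases hiu : i = u
    · subst hiu
      have hle := le_comp_swap_apply hij hlt.le h
      have hf : X i ^ a i ∣ keyPoly (a ∘ Equiv.swap i j) :=
        X_pow_dvd_keyPoly fun k hk => hle k (by grind)
      have hs := map_dvd (swapVars i j) (ih (u := j) (by simpa using hle))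
      simp only [Function.comp_apply, Equiv.swap_apply_right, map_pow, map_sub, map_mul,
        swapVars_X] at hs
      rw [swapVars, rename_rename, swap_comp_succAbove hij, Function.comp_assoc,
        swap_comp_succAbove hij] at hs
      exact X_pow_succ_dvd_isobaric_sub hne hf (dvd_mul_right _ _) hs
    · obtain ⟨i', rfl⟩ := Fin.exists_succAbove_eq hiu
      obtain ⟨j', rfl⟩ := Fin.exists_succAbove_eq hju
      have hij' : (j' : ℕ) = i' + 1 := val_eq_succ_of_succAbove hij
      have hu : Equiv.swap (u.succAbove i') (u.succAbove j') u = u :=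
        Equiv.swap_apply_of_ne_of_ne (Ne.symm hiu) (Ne.symm hju)
      have hcomp : (a ∘ Equiv.swap (u.succAbove i') (u.succAbove j')) ∘ u.succAbove =
          (a ∘ u.succAbove) ∘ Equiv.swap i' j' := by
        rw [Function.comp_assoc, Fin.succAbove_right_injective.swap_comp, Function.comp_assoc]
      obtain ⟨g, hg⟩ := ih (u := u) fun k hk => by
        simpa [hu] using h _ ((swap_apply_le_iff hij (Ne.symm hiu) k).2 hk)
      rw [Function.comp_apply, hu, hcomp] at hg
      refine ⟨isobaric (u.succAbove i') (u.succAbove j') g, ?_⟩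
      rw [← isobaric_X_pow_mul hne (Ne.symm hiu) (Ne.symm hju), ← hg, isobaric_sub hne,
        isobaric_X_pow_mul hne (Ne.symm hiu) (Ne.symm hju),
        keyPoly_eq_isobaric (a := a ∘ u.succAbove) hij' hlt,
        rename_isobaric Fin.succAbove_right_injective (ne_of_val_eq_succ hij')]

theorem eq_zero_of_X_dvd_rename {σ τ R : Type*} [CommSemiring R] {e : σ → τ}
    (he : Function.Injective e) {u : τ} (hu : u ∉ Set.range e) {g : MvPolynomial σ R}
    (h : X u ∣ rename e g) : g = 0 := by
  obtain ⟨q, hq⟩ := h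
  have := congrArg (killCompl he) hq
  rwa [killCompl_rename_app, map_mul, killCompl, aeval_X, dif_neg hu, zero_mul] at this

theorem sum_keyPoly_tail_eq_zero {s : Finset (Fin (n + 1) → ℕ)} {c : (Fin (n + 1) → ℕ) → ℚ}
    {m : ℕ} (hm : ∀ a ∈ s, m ≤ a 0) (h : ∑ a ∈ s, c a • keyPoly a = 0) :
    ∑ a ∈ s with a 0 = m, c a • keyPoly (a ∘ Fin.succ) = 0 := by
  have hlow : ∀ a ∈ s, X 0 ^ (m + 1) ∣ c a • keyPoly a -
      if a 0 = m then X 0 ^ m * rename Fin.succ (c a • keyPoly (a ∘ Fin.succ)) else 0 := by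
    intro a ha
    split_ifs with h0
    · rw [map_smul, mul_smul_comm, ← smul_sub, ← h0, ← Fin.succAbove_zero]
      exact dvd_smul_of_dvd _ (X_pow_succ_dvd_keyPoly_sub fun k hk => by rw [Fin.le_zero_iff.1 hk])
    · rw [sub_zero]
      refine dvd_smul_of_dvd _ (X_pow_dvd_keyPoly fun k hk => ?_)
      rw [Fin.le_zero_iff.1 hk]
      exact (hm a ha).lt_of_ne' h0
  have hsum := Finset.dvd_sum hlow
  rw [Finset.sum_sub_distrib, h, zero_sub, dvd_neg, ← Finset.sum_filter, ← Finset.mul_sum,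
    ← map_sum, pow_succ, mul_dvd_mul_iff_left (pow_ne_zero m (X_ne_zero 0))] at hsum
  exact eq_zero_of_X_dvd_rename (Fin.succ_injective n) (by simp) hsum

theorem linearIndependent_keyPoly (n : ℕ) :
    LinearIndependent ℚ (keyPoly : (Fin n → ℕ) → MvPolynomial (Fin n) ℚ) := by
  induction n with
  | zero =>
    refine LinearIndependent.of_subsingleton 0 ?_
    rw [keyPoly_of_antitone fun k => k.elim0, Fin.prod_univ_zero]
    exact one_ne_zero
  | succ n ih =>
    refine linearIndependent_iff.2 fun c hc => ?_
    by_contra hne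
    obtain ⟨b, hb, hmin⟩ :=
      c.support.exists_min_image (fun a => a 0) (Finsupp.support_nonempty_iff.2 hne)
    have hinj : Function.Injective
        fun a : {a : Fin (n + 1) → ℕ | a 0 = b 0} => a.1 ∘ Fin.succ := fun a a' h =>
      Subtype.ext <| funext <| Fin.cases (a.2.trans a'.2.symm) (congrFun h)
    have htail : LinearIndepOn ℚ (fun a => keyPoly (a ∘ Fin.succ))
        {a : Fin (n + 1) → ℕ | a 0 = b 0} := ih.comp _ hinj
    have hsum := sum_keyPoly_tail_eq_zero hmin hc
    have hcb := linearIndepOn_iff'.1 htail _ c (by simp [Set.subset_def]) hsum b (by simpa using hb)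
    exact Finsupp.mem_support_iff.1 hb hcb

end KeyPoly

/-! ### Key polynomials of lists of variables with exponents -/

section KeyList

variable {σ τ : Type*}

theorem coeff_eq_of_X_dvd_sub {R : Type*} [CommRing R] {f g : MvPolynomial σ R} {u : σ}
    (h : X u ∣ f - g) {d : σ →₀ ℕ} (hd : d u = 0) : f.coeff d = g.coeff d := by
  classical
  obtain ⟨q, hq⟩ := h
  rw [← sub_eq_zero, ← coeff_sub, hq, coeff_X_mul', if_neg (by simpa using hd)]

theorem coeff_rename_keyPoly_succAbove {n : ℕ} {a : Fin (n + 1) → ℕ} {u : Fin (n + 1)}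
    (ha : a u = 0) (v : Fin (n + 1) → σ) {d : σ →₀ ℕ} (hd : d (v u) = 0) :
    (rename v (keyPoly a)).coeff d =
      (rename (v ∘ u.succAbove) (keyPoly (a ∘ u.succAbove))).coeff d := by
  have h := map_dvd (rename v) (X_pow_succ_dvd_keyPoly_sub (a := a) (u := u)
    fun k _ => by rw [ha]; exact Nat.zero_le _)
  simp only [ha, zero_add, pow_one, pow_zero, one_mul, map_sub, rename_X, rename_rename] at h
  exact coeff_eq_of_X_dvd_sub h hd

/-- The key polynomial of a composition whose `k`-th entry is attached to the variable given by the
`k`-th element of the list. -/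
def keyList (l : List (σ × ℕ)) : MvPolynomial σ ℚ :=
  rename (fun k : Fin l.length => l[k].1) (keyPoly fun k => l[k].2)

theorem keyList_eq {n : ℕ} {l : List (σ × ℕ)} (hn : l.length = n) {v : Fin n → σ} {a : Fin n → ℕ}
    (h : ∀ k : Fin n, l[k] = (v k, a k)) : keyList l = rename v (keyPoly a) := by
  subst hn
  simp only [keyList, h]

theorem keyList_ofFn {n : ℕ} (v : Fin n → σ) (a : Fin n → ℕ) :
    keyList (List.ofFn fun k => (v k, a k)) = rename v (keyPoly a) :=
  keyList_eq List.length_ofFn fun k => by simp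

theorem rename_keyList (e : σ → τ) (l : List (σ × ℕ)) :
    rename e (keyList l) = keyList (l.map (Prod.map e id)) := by
  rw [keyList, rename_rename]
  exact (keyList_eq (List.length_map _) fun k => by simp [Prod.map]).symm

theorem coeff_keyList_append_zero_cons (l m : List (σ × ℕ)) {u : σ} {d : σ →₀ ℕ} (hd : d u = 0) :
    (keyList (l ++ (u, 0) :: m)).coeff d = (keyList (l ++ m)).coeff d := by
  have hn : (l ++ (u, 0) :: m).length = (l ++ m).length + 1 := by simp +arith
  let L : Fin ((l ++ m).length + 1) → σ × ℕ := fun k => (l ++ (u, 0) :: m)[k]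
  let p : Fin ((l ++ m).length + 1) := ⟨l.length, by simp +arith⟩
  have hp : L p = (u, 0) := by simp [L, p]
  rw [keyList_eq hn (v := fun k => (L k).1) (a := fun k => (L k).2) fun k => rfl,
    keyList_eq rfl (v := (fun k => (L k).1) ∘ p.succAbove)
      (a := (fun k => (L k).2) ∘ p.succAbove) fun k => ?_]
  · exact coeff_rename_keyPoly_succAbove (by rw [hp]) _ (by rwa [hp])
  · simp only [Function.comp_apply, L, Fin.succAbove, p, Fin.lt_def, Fin.getElem_fin,
      List.getElem_append, List.getElem_cons]
    grind

theorem keyList_append_cons_cons_swap (l m : List (σ × ℕ)) (u v : σ) {a b : ℕ} (hab : a ≤ b) :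
    keyList (l ++ (u, a) :: (v, b) :: m) = keyList (l ++ (v, a) :: (u, b) :: m) := by
  set L := l ++ (u, a) :: (v, b) :: m
  have hlen : L.length = l.length + (m.length + 1 + 1) := by simp [L]
  let i : Fin L.length := ⟨l.length, by omega⟩
  let j : Fin L.length := ⟨l.length + 1, by omega⟩
  have h : swapVars i j (keyPoly fun k => L[k].2) = keyPoly fun k => L[k].2 :=
    swapVars_keyPoly_of_le rfl (by simpa [L, i, j] using hab)
  rw [keyList, ← h, swapVars, rename_rename]
  refine (keyList_eq (by simp [L]) fun k => ?_).symm
  simp only [Function.comp_apply, Equiv.swap_apply_def, Fin.ext_iff, Fin.getElem_fin, i, j]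
  grind

end KeyList

/-! ### Schur blocks -/

section SchurBlock

variable {σ τ : Type*} {μ : YoungDiagram}

theorem rowLen_eq_zero {n : ℕ} (h : μ.colLen 0 ≤ n) : μ.rowLen n = 0 := by
  by_contra hne
  have hmem : (n, 0) ∈ μ := YoungDiagram.mem_iff_lt_rowLen.2 (Nat.pos_of_ne_zero hne)
  exact (YoungDiagram.mem_iff_lt_colLen.1 hmem).not_ge h

theorem sum_range_rowLen {n : ℕ} (h : μ.colLen 0 ≤ n) :
    ∑ i ∈ Finset.range n, μ.rowLen i = μ.card := by
  rw [YoungDiagram.card, Finset.card_eq_sum_card_fiberwise (f := Prod.fst) (t := Finset.range n)]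
  · exact Finset.sum_congr rfl fun i _ => μ.rowLen_eq_card
  · rintro ⟨i, j⟩ hij
    have hi : (i, 0) ∈ μ := μ.up_left_mem le_rfl (Nat.zero_le j) ((μ.mem_cells _).1 hij)
    exact Finset.mem_coe.2 (Finset.mem_range.2 ((YoungDiagram.mem_iff_lt_colLen.1 hi).trans_le h))

/-- The variables `vs` with the parts of `μ` in weakly increasing order as exponents, preceded by
zeros if `vs` has more than `ℓ(μ)` elements: the exponent of a variable is the part of `μ` whose
index is the number of variables after it. -/
def schurBlock (μ : YoungDiagram) : List σ → List (σ × ℕ)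
  | [] => []
  | u :: vs => (u, μ.rowLen vs.length) :: schurBlock μ vs

theorem map_schurBlock (e : σ → τ) (vs : List σ) :
    (schurBlock μ vs).map (Prod.map e id) = schurBlock μ (vs.map e) := by
  induction vs with
  | nil => rfl
  | cons u vs ih => simp [schurBlock, ih]

theorem ofFn_rowLen_rev {n : ℕ} (v : Fin n → σ) :
    List.ofFn (fun j => (v j, μ.rowLen j.rev)) = schurBlock μ (List.ofFn v) := by
  induction n with
  | zero => simp [schurBlock]
  | succ n ih =>
    simp only [List.ofFn_succ, schurBlock, ← ih]
    simp [Fin.val_rev]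

theorem keyList_schurBlock_perm {vs ws : List σ} (h : vs.Perm ws) (p q : List (σ × ℕ)) :
    keyList (p ++ schurBlock μ vs ++ q) = keyList (p ++ schurBlock μ ws ++ q) := by
  induction h generalizing p with
  | nil => rfl
  | @cons u l₁ l₂ hperm ih =>
    simpa [schurBlock, hperm.length_eq] using ih (p ++ [(u, μ.rowLen l₁.length)])
  | swap u v l =>
    simpa [schurBlock] using keyList_append_cons_cons_swap p (schurBlock μ l ++ q) v u
      (μ.rowLen_anti _ _ (Nat.le_succ _))
  | trans _ _ ih₁ ih₂ => exact (ih₁ p).trans (ih₂ p)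

theorem coeff_keyList_schurBlock_append {us vs : List σ} (hvs : μ.colLen 0 ≤ vs.length)
    {d : σ →₀ ℕ} (hd : ∀ u ∈ us, d u = 0) (p q : List (σ × ℕ)) :
    (keyList (p ++ schurBlock μ (us ++ vs) ++ q)).coeff d =
      (keyList (p ++ schurBlock μ vs ++ q)).coeff d := by
  induction us with
  | nil => rfl
  | cons u us ih =>
    rw [List.forall_mem_cons] at hd
    have h0 : μ.rowLen (us ++ vs).length = 0 := rowLen_eq_zero (hvs.trans (by simp))
    rw [← ih hd.2, List.cons_append, schurBlock, h0]
    simpa only [List.append_assoc, List.cons_append] using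
      coeff_keyList_append_zero_cons p (schurBlock μ (us ++ vs) ++ q) hd.1

theorem coeff_keyList_schurBlock_of_subset {vs ws : List σ} (hvs : vs.Nodup) (hws : ws.Nodup)
    (hsub : vs ⊆ ws) (hlen : μ.colLen 0 ≤ vs.length) {d : σ →₀ ℕ}
    (hd : ∀ u ∈ ws, u ∉ vs → d u = 0) (p q : List (σ × ℕ)) :
    (keyList (p ++ schurBlock μ ws ++ q)).coeff d =
      (keyList (p ++ schurBlock μ vs ++ q)).coeff d := by
  obtain ⟨vs', hvs', hsublist⟩ := List.subperm_of_subset hvs hsub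
  obtain ⟨us, hus⟩ := hsublist.exists_perm_append
  have hperm : ws.Perm (us ++ vs) :=
    hus.trans ((hvs'.append_right us).trans List.perm_append_comm)
  have hdisj := List.disjoint_of_nodup_append (hperm.nodup hws)
  rw [keyList_schurBlock_perm hperm]
  exact coeff_keyList_schurBlock_append hlen
    (fun u hu => hd u (hperm.symm.subset (List.mem_append_left _ hu)) (hdisj hu)) p q

end SchurBlock

/-! ### Multi-symmetric Schur polynomials -/

theorem apply_append_flatMap_congr {ι α β : Type*} (F : List α → β) {f g : ι → List α}
    (h : ∀ i p q, F (p ++ f i ++ q) = F (p ++ g i ++ q)) (l : List ι) (p : List α) :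
    F (p ++ l.flatMap f) = F (p ++ l.flatMap g) := by
  induction l generalizing p with
  | nil => rfl
  | cons i l ih =>
    simpa only [List.flatMap_cons, List.append_assoc] using
      (h i p (l.flatMap f)).trans (ih (p ++ g i))

theorem ofFn_finSigmaFinEquiv_symm {α : Type*} {r : ℕ} {n : Fin r → ℕ}
    (g : (i : Fin r) × Fin (n i) → α) :
    List.ofFn (fun k => g (finSigmaFinEquiv.symm k)) =
      (List.finRange r).flatMap fun i => List.ofFn fun j => g ⟨i, j⟩ := by
  induction r with
  | zero => simp
  | succ r ih =>
    have ih' := ih (n := fun i => n i.castSucc) fun x => g ⟨x.1.castSucc, x.2⟩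
    rw [List.ofFn_congr (Fin.sum_univ_castSucc n), List.ofFn_add, List.finRange_succ_last,
      List.flatMap_append, List.flatMap_map, ← ih', List.flatMap_singleton]
    congr 2 <;> funext k <;> congr 1 <;> rw [Equiv.symm_apply_eq] <;> apply Fin.ext <;>
      rw [finSigmaFinEquiv_apply]
    · have h := finSigmaFinEquiv_apply (finSigmaFinEquiv.symm k)
      rwa [Equiv.apply_symm_apply] at h
    · simp only [Fin.val_cast, Fin.val_natAdd, Fin.val_last, Nat.add_right_cancel_iff]
      rfl

section MultiSchurPoly

variable {σ τ : Type*} {r : ℕ} {lam : Fin r → YoungDiagram}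

/-- The multi-symmetric Schur polynomial whose `i`-th block of variables is the list `vs i`. -/
def blockSchurPoly (lam : Fin r → YoungDiagram) (vs : Fin r → List σ) : MvPolynomial σ ℚ :=
  keyList ((List.finRange r).flatMap fun i => schurBlock (lam i) (vs i))

theorem rename_blockSchurPoly (e : σ → τ) (vs : Fin r → List σ) :
    rename e (blockSchurPoly lam vs) = blockSchurPoly lam fun i => (vs i).map e := by
  simp only [blockSchurPoly, rename_keyList, List.map_flatMap, map_schurBlock]

theorem coeff_blockSchurPoly_of_subset {vs ws : Fin r → List σ} (hvs : ∀ i, (vs i).Nodup)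
    (hws : ∀ i, (ws i).Nodup) (hsub : ∀ i, vs i ⊆ ws i)
    (hlen : ∀ i, (lam i).colLen 0 ≤ (vs i).length) {d : σ →₀ ℕ}
    (hd : ∀ i, ∀ u ∈ ws i, u ∉ vs i → d u = 0) :
    (blockSchurPoly lam ws).coeff d = (blockSchurPoly lam vs).coeff d :=
  apply_append_flatMap_congr (fun l => (keyList l).coeff d)
    (fun i => coeff_keyList_schurBlock_of_subset (hvs i) (hws i) (hsub i) (hlen i) (hd i)) _ []

theorem multiSchurPoly_eq_blockSchurPoly (lam : Fin r → YoungDiagram) (n : Fin r → ℕ) :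
    multiSchurPoly lam n = blockSchurPoly lam fun i => (List.range (n i)).map (Prod.mk i) := by
  simp only [multiSchurPoly, ← keyList_ofFn, blockSchurPoly, blockComposition]
  rw [ofFn_finSigmaFinEquiv_symm fun x => ((x.1, (x.2 : ℕ)), (lam x.1).rowLen x.2.rev)]
  congr! 3 with i
  refine (ofFn_rowLen_rev (μ := lam i) fun j : Fin (n i) => (i, (j : ℕ))).trans (congrArg _ ?_)
  exact List.ext_getElem (by simp) fun k _ _ => by simp

theorem blockComposition_finSigmaFinEquiv (lam : Fin r → YoungDiagram) {n : Fin r → ℕ}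
    (x : (i : Fin r) × Fin (n i)) :
    blockComposition lam n (finSigmaFinEquiv x) = (lam x.1).rowLen x.2.rev :=
  congrArg (fun y : (i : Fin r) × Fin (n i) => (lam y.1).rowLen y.2.rev)
    (finSigmaFinEquiv.symm_apply_apply x)

theorem isHomogeneous_multiSchurPoly {n : Fin r → ℕ} (hn : ∀ i, (lam i).colLen 0 ≤ n i) :
    (multiSchurPoly lam n).IsHomogeneous (∑ i, (lam i).card) := by
  have hsum : ∑ k, blockComposition lam n k = ∑ i, (lam i).card := by
    rw [← finSigmaFinEquiv.sum_comp, Fintype.sum_sigma]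
    refine Finset.sum_congr rfl fun i _ => ?_
    simp only [blockComposition_finSigmaFinEquiv]
    rw [← sum_range_rowLen (hn i), ← Fin.sum_univ_eq_sum_range]
    exact Equiv.sum_comp Fin.revPerm fun j : Fin (n i) => (lam i).rowLen j
  exact hsum ▸ (isHomogeneous_keyPoly _).rename_isHomogeneous

theorem lt_of_mem_vars_multiSchurPoly {n : Fin r → ℕ} {i : Fin r} {j : ℕ}
    (h : (i, j) ∈ (multiSchurPoly lam n).vars) : j < n i := by
  obtain ⟨k, -, hk⟩ := Finset.mem_image.1 (vars_rename _ _ h)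
  simp only [Prod.mk.injEq] at hk
  obtain ⟨rfl, rfl⟩ := hk
  exact (finSigmaFinEquiv.symm k).2.isLt

theorem blockComposition_injOn (n : Fin r → ℕ) :
    Set.InjOn (fun lam : Fin r → YoungDiagram => blockComposition lam n)
      {lam | ∀ i, (lam i).colLen 0 ≤ n i} := by
  intro lam hlam mu hmu h
  have hrow (i : Fin r) (k : ℕ) : (lam i).rowLen k = (mu i).rowLen k := by
    rcases lt_or_ge k (n i) with hk | hk
    · have := congrFun h (finSigmaFinEquiv ⟨i, (⟨k, hk⟩ : Fin (n i)).rev⟩)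
      simpa only [blockComposition_finSigmaFinEquiv, Fin.rev_rev] using this
    · rw [rowLen_eq_zero ((hlam i).trans hk), rowLen_eq_zero ((hmu i).trans hk)]
  funext i
  ext ⟨a, b⟩
  rw [YoungDiagram.mem_cells, YoungDiagram.mem_cells, YoungDiagram.mem_iff_lt_rowLen,
    YoungDiagram.mem_iff_lt_rowLen, hrow]

theorem linearIndepOn_multiSchurPoly (n : Fin r → ℕ) :
    LinearIndepOn ℚ (fun lam : Fin r → YoungDiagram => multiSchurPoly lam n)
      {lam | ∀ i, (lam i).colLen 0 ≤ n i} := by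
  have hinj : Function.Injective fun k : Fin (∑ i, n i) =>
      ((finSigmaFinEquiv.symm k).1, ((finSigmaFinEquiv.symm k).2 : ℕ)) := by
    intro k l h
    rw [Prod.mk.injEq] at h
    exact finSigmaFinEquiv.symm.injective
      (Sigma.ext h.1 ((Fin.heq_ext_iff (congrArg n h.1)).2 h.2))
  have hkey := (linearIndependent_keyPoly (∑ i, n i)).comp _ (blockComposition_injOn n).injective
  exact hkey.map' (rename _).toLinearMap (LinearMap.ker_eq_bot.2 (rename_injective _ hinj))

end MultiSchurPoly

/-! ### Monomial symmetric functions -/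

section Exponents

variable {σ : Type*} {e e' : σ →₀ ℕ}

/-- The multiset of the nonzero exponents of a monomial. -/
def exponents (e : σ →₀ ℕ) : Multiset ℕ :=
  e.support.val.map e

theorem exists_support_equiv_of_exponents_eq (h : exponents e = exponents e') :
    ∃ φ : e.support ≃ e'.support, ∀ x, e' (φ x) = e x := by
  have hcard (f : σ →₀ ℕ) (c : ℕ) :
      Fintype.card {x : f.support // f x = c} = (exponents f).count c := by
    rw [Fintype.card_subtype, exponents, Multiset.count_map, ← Finset.filter_val, Finset.card_val,
      ← Finset.card_map (Function.Embedding.subtype _)]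
    congr 1
    ext x
    simp [eq_comm, and_comm]
  have hfib (c : ℕ) : Nonempty ({x : e.support // e x = c} ≃ {x : e'.support // e' x = c}) :=
    Fintype.card_eq.1 (by rw [hcard, hcard, h])
  exact ⟨Equiv.ofFiberEquiv fun c => (hfib c).some,
    Equiv.ofFiberEquiv_map (g := fun x : e'.support => e' x) _⟩

theorem exists_perm_of_exponents_eq (h : exponents e = exponents e') :
    ∃ s : Equiv.Perm σ, ∀ x, e' (s x) = e x := by
  obtain ⟨φ, hφ⟩ := exists_support_equiv_of_exponents_eq h
  obtain ⟨s, hs⟩ := Equiv.Perm.exists_extending_pair (Subtype.val : e.support → σ)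
    (fun x => (φ x : σ)) Subtype.val_injective (Subtype.val_injective.comp φ.injective)
  refine ⟨s, fun x => ?_⟩
  by_cases hx : x ∈ e.support
  · rw [hs ⟨x, hx⟩, hφ]
  · rw [Finsupp.notMem_support_iff.1 hx]
    by_contra hne
    obtain ⟨y, hy⟩ := φ.surjective ⟨s x, Finsupp.mem_support_iff.2 hne⟩
    have hsy : s y = s x := (hs y).trans (congrArg Subtype.val hy)
    exact hx (s.injective hsy ▸ y.2)

theorem exponents_eq_of_perm (s : Equiv.Perm σ) (h : ∀ x, e' (s x) = e x) :
    exponents e' = exponents e := by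
  have hmap : e'.support = e.support.map s.toEmbedding := by
    ext x
    obtain ⟨y, rfl⟩ := s.surjective x
    simp [h]
  simp [exponents, hmap, h]

end Exponents

/-- The exponent vector of the monomial in which the parts of `μ` are, in order, the exponents of
the first variables. -/
def rowExponent (μ : YoungDiagram) : ℕ →₀ ℕ :=
  Finsupp.onFinset (Finset.range (μ.colLen 0)) μ.rowLen fun j hj => by
    rw [Finset.mem_range]
    exact lt_of_not_ge fun h => hj (rowLen_eq_zero h)

theorem degree_rowExponent (μ : YoungDiagram) : (rowExponent μ).degree = μ.card := by
  rw [← sum_range_rowLen le_rfl]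
  exact Finset.sum_subset (f := rowExponent μ) Finsupp.support_onFinset_subset
    fun _ _ => Finsupp.notMem_support_iff.1

theorem exponents_rowExponent (μ : YoungDiagram) : exponents (rowExponent μ) = μ.rowLens := by
  have hsupport : (rowExponent μ).support = Finset.range (μ.colLen 0) := by
    refine Finsupp.support_onFinset_subset.antisymm fun j hj => ?_
    rw [Finset.mem_range, ← YoungDiagram.mem_iff_lt_colLen, YoungDiagram.mem_iff_lt_rowLen] at hj
    exact Finsupp.mem_support_iff.2 hj.ne'
  rw [exponents, hsupport]
  rfl

theorem exponents_rowExponent_injective :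
    Function.Injective fun μ : YoungDiagram => exponents (rowExponent μ) := by
  intro μ ν h
  simp only [exponents_rowExponent, Multiset.coe_eq_coe] at h
  exact YoungDiagram.equivListRowLens.injective (Subtype.ext
    (h.eq_of_pairwise' μ.rowLens_sorted.pairwise ν.rowLens_sorted.pairwise))

section Shape

variable {σ : Type*} {e e' : σ →₀ ℕ}

/-- The partition formed by the exponents of a monomial. -/
def shape (e : σ →₀ ℕ) : YoungDiagram :=
  YoungDiagram.ofRowLens ((exponents e).sort (· ≥ ·)) (Multiset.pairwise_sort _ _).sortedGE

theorem exponents_rowExponent_shape (e : σ →₀ ℕ) :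
    exponents (rowExponent (shape e)) = exponents e := by
  rw [exponents_rowExponent, shape, YoungDiagram.rowLens_ofRowLens_eq_self, Multiset.sort_eq]
  intro x hx
  rw [Multiset.mem_sort, exponents, Multiset.mem_map] at hx
  obtain ⟨a, ha, rfl⟩ := hx
  exact Nat.pos_of_ne_zero (Finsupp.mem_support_iff.1 ha)

theorem shape_congr (h : exponents e = exponents e') : shape e = shape e' :=
  exponents_rowExponent_injective (by simpa only [exponents_rowExponent_shape] using h)

theorem shape_rowExponent (μ : YoungDiagram) : shape (rowExponent μ) = μ :=
  exponents_rowExponent_injective (exponents_rowExponent_shape _)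

theorem card_shape (e : σ →₀ ℕ) : (shape e).card = e.degree := by
  rw [← degree_rowExponent]
  exact congrArg Multiset.sum (exponents_rowExponent_shape e)

end Shape

theorem finite_card_le (N : ℕ) : {μ : YoungDiagram | μ.card ≤ N}.Finite := by
  refine Set.Finite.of_finite_image (f := YoungDiagram.cells)
    ((Finset.range N ×ˢ Finset.range N).powerset.finite_toSet.subset ?_)
    fun μ _ ν _ h => YoungDiagram.ext h
  rintro _ ⟨μ, hμ : μ.card ≤ N, rfl⟩
  rw [Finset.mem_coe, Finset.mem_powerset]
  rintro ⟨i, j⟩ hij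
  have hle : (i + 1) * (j + 1) ≤ μ.card := by
    have := Finset.card_le_card (s := Finset.Iic i ×ˢ Finset.Iic j) (t := μ.cells) fun x hx => by
      simp only [Finset.mem_product, Finset.mem_Iic] at hx
      exact μ.isLowerSet (show x ≤ (i, j) from hx) hij
    rwa [Finset.card_product, Nat.card_Iic, Nat.card_Iic] at this
  rw [Finset.mem_product, Finset.mem_range, Finset.mem_range]
  constructor <;> nlinarith

theorem coeff_rename_perm {σ R : Type*} [CommSemiring R] (s : Equiv.Perm σ)
    (f : MvPowerSeries σ R) {e e' : σ →₀ ℕ} (h : ∀ j, e' (s j) = e j) :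
    (MvPowerSeries.rename s f).coeff e' = f.coeff e := by
  have he : e' = e.embDomain s.toEmbedding := by
    ext j
    obtain ⟨k, rfl⟩ := s.surjective j
    exact (h k).trans (Finsupp.embDomain_apply_self s.toEmbedding e k).symm
  rw [he]
  exact MvPowerSeries.coeff_embDomain_rename s.toEmbedding f e

theorem coeff_eq_of_exponents_eq (f : SymmFun) {e e' : ℕ →₀ ℕ} (h : exponents e = exponents e') :
    f.1.coeff e = f.1.coeff e' := by
  obtain ⟨s, hs⟩ := exists_perm_of_exponents_eq h
  rw [← coeff_rename_perm s f.1 hs, f.2.2 s]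

open Classical in
/-- The monomial symmetric function of a partition: the sum of all monomials of shape `μ`. -/
def monomialSymm (μ : YoungDiagram) : SymmFun where
  val := fun e => if shape e = μ then 1 else 0
  property := by
    refine ⟨⟨μ.card, fun e he => ?_⟩, fun s => ?_⟩
    · have hshape : shape e = μ := by_contra fun h => he (if_neg h)
      rw [← hshape, card_shape]
    · ext e
      have hperm (j : ℕ) : e (s j) = Finsupp.equivMapDomain s.symm e j := rfl
      refine (coeff_rename_perm s _ hperm).trans ?_
      exact if_congr (by rw [shape_congr (exponents_eq_of_perm s hperm)]) rfl rfl

open Classical in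
theorem coeff_monomialSymm (μ : YoungDiagram) (e : ℕ →₀ ℕ) :
    (monomialSymm μ).1.coeff e = if shape e = μ then 1 else 0 :=
  rfl

/-- The coefficient of a monomial in a symmetric function, as a linear map. -/
def symmCoeff (e : ℕ →₀ ℕ) : SymmFun →ₗ[ℚ] ℚ :=
  (MvPowerSeries.coeff e).comp SymmFun.val.toLinearMap

theorem symmCoeff_apply (e : ℕ →₀ ℕ) (f : SymmFun) : symmCoeff e f = f.1.coeff e :=
  rfl

theorem linearIndependent_monomialSymm : LinearIndependent ℚ monomialSymm := by
  classical
  rw [linearIndependent_iff]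
  intro c hc
  ext μ
  have h := congrArg (symmCoeff (rowExponent μ)) hc
  rw [Finsupp.linearCombination_apply, Finsupp.sum, map_sum] at h
  simpa [symmCoeff_apply, coeff_monomialSymm, shape_rowExponent] using h

theorem span_monomialSymm : Submodule.span ℚ (Set.range monomialSymm) = ⊤ := by
  classical
  refine Submodule.eq_top_iff'.2 fun f => ?_
  obtain ⟨N, hN⟩ := f.2.1
  have hf : f = ∑ μ ∈ (finite_card_le N).toFinset,
      symmCoeff (rowExponent μ) f • monomialSymm μ := by
    apply Subtype.ext
    ext e
    rw [← symmCoeff_apply, ← symmCoeff_apply, map_sum]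
    simp only [map_smul, symmCoeff_apply, coeff_monomialSymm, smul_eq_mul, mul_ite, mul_one,
      mul_zero, Finset.sum_ite_eq, Set.Finite.mem_toFinset, Set.mem_ofPred_eq, card_shape]
    rw [coeff_eq_of_exponents_eq f (exponents_rowExponent_shape e)]
    exact (ite_eq_left_iff.2 fun h => (not_imp_comm.1 (hN e) h).symm).symm
  rw [hf]
  exact Submodule.sum_mem _ fun μ _ => Submodule.smul_mem _ _ (Submodule.subset_span ⟨μ, rfl⟩)

/-- The basis of `Λ(X)` consisting of the monomial symmetric functions. -/
def monomialBasis : Module.Basis YoungDiagram ℚ SymmFun :=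
  .mk linearIndependent_monomialSymm span_monomialSymm.ge

theorem monomialBasis_apply (μ : YoungDiagram) : monomialBasis μ = monomialSymm μ :=
  Module.Basis.mk_apply _ _ μ

/-! ### Expansions of multi-symmetric functions -/

section Blocks

variable {ι κ : Type*} [Fintype ι]

/-- The exponent vector of the monomial whose exponents in the `i`-th set of variables are given by
`e i`, for every `i`; these exponents are recovered by `Finsupp.curry`. -/
def ofBlocks (e : ι → κ →₀ ℕ) : ι × κ →₀ ℕ :=
  (Finsupp.equivFunOnFinite.symm e).uncurry

theorem curry_ofBlocks (e : ι → κ →₀ ℕ) (i : ι) : (ofBlocks e).curry i = e i := by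
  rw [ofBlocks, Finsupp.curry_uncurry, Finsupp.equivFunOnFinite_symm_apply_apply]

theorem ofBlocks_curry (d : ι × κ →₀ ℕ) : ofBlocks (fun i => d.curry i) = d := by
  ext ⟨i, j⟩
  rw [← Finsupp.curry_apply, curry_ofBlocks, Finsupp.curry_apply]

theorem ofBlocks_eq_sum (e : ι → κ →₀ ℕ) :
    ofBlocks e = ∑ i, (e i).embDomain (Function.Embedding.sectR i κ) := by
  ext ⟨i, j⟩
  rw [← Finsupp.curry_apply, curry_ofBlocks, Finsupp.finsetSum_apply, Finset.sum_eq_single i]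
  · exact (Finsupp.embDomain_apply_self (Function.Embedding.sectR i κ) (e i) j).symm
  · intro k _ hk
    refine Finsupp.embDomain_of_notMem_range _ _ _ ?_
    rintro ⟨a, ha⟩
    exact hk (congrArg Prod.fst ha)
  · simp

theorem degree_eq_sum_curry (d : ι × κ →₀ ℕ) : d.degree = ∑ i, (d.curry i).degree := by
  conv_lhs => rw [← ofBlocks_curry d, ofBlocks_eq_sum, map_sum]
  simp only [Finsupp.embDomain_eq_mapDomain, Finsupp.degree_mapDomain]

end Blocks

section Expansion

variable {r : ℕ}

theorem coeff_prod_rename_mk {R : Type*} [CommSemiring R] (f : Fin r → MvPowerSeries ℕ R)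
    (d : Fin r × ℕ →₀ ℕ) :
    (∏ i, MvPowerSeries.rename (Prod.mk i) (f i)).coeff d = ∏ i, (f i).coeff (d.curry i) := by
  classical
  let l₀ : Fin r →₀ (Fin r × ℕ →₀ ℕ) := Finsupp.equivFunOnFinite.symm fun i =>
    (d.curry i).embDomain (Function.Embedding.sectR i ℕ)
  rw [MvPowerSeries.coeff_prod, Finset.sum_eq_single l₀]
  · exact Finset.prod_congr rfl fun i _ =>
      MvPowerSeries.coeff_embDomain_rename (Function.Embedding.sectR i ℕ) _ _
  · intro l hl hne
    by_contra h
    have hrange (i : Fin r) :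
        ∃ e : ℕ →₀ ℕ, e.embDomain (Function.Embedding.sectR i ℕ) = l i := by
      by_contra hi
      refine h (Finset.prod_eq_zero (Finset.mem_univ i) (MvPowerSeries.coeff_rename_eq_zero _ _ ?_))
      rintro ⟨e, he⟩
      exact hi ⟨e, (Finsupp.embDomain_eq_mapDomain _ _).trans he⟩
    choose e he using hrange
    have hd : d = ofBlocks e := by
      rw [← (Finset.mem_finsuppAntidiag.1 hl).1, ofBlocks_eq_sum]
      exact Finset.sum_congr rfl fun k _ => (he k).symm
    refine hne (Finsupp.ext fun i => ?_)
    rw [← he i, Finsupp.equivFunOnFinite_symm_apply_apply, hd, curry_ofBlocks]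
  · have hsum : ∑ i, l₀ i = d := (ofBlocks_eq_sum _).symm.trans (ofBlocks_curry d)
    exact fun h => absurd (Finset.mem_finsuppAntidiag.2 ⟨hsum, Finset.subset_univ _⟩) h

theorem coeff_expand_tprod (f : Fin r → SymmFun) (d : Fin r × ℕ →₀ ℕ) :
    (expand r (PiTensorProduct.tprod ℚ f)).coeff d = ∏ i, (f i).1.coeff (d.curry i) := by
  rw [← coeff_prod_rename_mk]
  simp [expand]

/-- The basis of `Λ(X_1|⋯|X_r)` consisting of the tensor products of monomial symmetric
functions. -/
def multiMonomialBasis (r : ℕ) : Module.Basis (Fin r → YoungDiagram) ℚ (MultiSymmFun r) :=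
  Basis.piTensorProduct fun _ => monomialBasis

theorem coeff_expand (f : MultiSymmFun r) (d : Fin r × ℕ →₀ ℕ) :
    (expand r f).coeff d = (multiMonomialBasis r).repr f fun i => shape (d.curry i) := by
  classical
  have h : (MvPowerSeries.coeff d).comp (expand r) =
      (Finsupp.lapply fun i => shape (d.curry i)).comp
        (multiMonomialBasis r).repr.toLinearMap := by
    refine (multiMonomialBasis r).ext fun μ => ?_
    simp only [LinearMap.comp_apply, LinearEquiv.coe_coe, Module.Basis.repr_self,
      Finsupp.lapply_apply]
    rw [multiMonomialBasis, Basis.piTensorProduct_apply, coeff_expand_tprod]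
    simp only [monomialBasis_apply, coeff_monomialSymm, Finsupp.single_apply,
      Fintype.prod_ite_zero, Finset.prod_const_one, funext_iff, eq_comm]
  exact DFunLike.congr_fun h f

/-- The exponent vector of the product over `i` of the monomials `rowExponent (μ i)` in the `i`-th
set of variables. -/
def multiRowExponent (μ : Fin r → YoungDiagram) : Fin r × ℕ →₀ ℕ :=
  ofBlocks fun i => rowExponent (μ i)

theorem shape_curry_multiRowExponent (μ : Fin r → YoungDiagram) (i : Fin r) :
    shape ((multiRowExponent μ).curry i) = μ i := by
  rw [multiRowExponent, curry_ofBlocks, shape_rowExponent]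

theorem degree_multiRowExponent (μ : Fin r → YoungDiagram) :
    (multiRowExponent μ).degree = ∑ i, (μ i).card := by
  simp only [degree_eq_sum_curry, multiRowExponent, curry_ofBlocks, degree_rowExponent]

theorem multiMonomialBasis_repr (f : MultiSymmFun r) (μ : Fin r → YoungDiagram) :
    (multiMonomialBasis r).repr f μ = (expand r f).coeff (multiRowExponent μ) := by
  simp only [coeff_expand, shape_curry_multiRowExponent]

theorem expand_injective (r : ℕ) : Function.Injective (expand r) := fun f g h =>
  (multiMonomialBasis r).ext_elem fun μ => by
    rw [multiMonomialBasis_repr, multiMonomialBasis_repr, h]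

theorem finite_sum_card_le (ι : Type*) [Fintype ι] (N : ℕ) :
    {μ : ι → YoungDiagram | ∑ i, (μ i).card ≤ N}.Finite :=
  (Set.Finite.pi' fun _ : ι => finite_card_le N).subset fun μ hμ i =>
    (Finset.single_le_sum (f := fun i => (μ i).card) (fun _ _ => Nat.zero_le _)
      (Finset.mem_univ i)).trans hμ

theorem mem_range_expand {F : MvPowerSeries (Fin r × ℕ) ℚ} {N : ℕ}
    (hdeg : ∀ d, F.coeff d ≠ 0 → d.degree ≤ N)
    (hsymm : ∀ d d' : Fin r × ℕ →₀ ℕ,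
      (∀ i, exponents (d.curry i) = exponents (d'.curry i)) → F.coeff d = F.coeff d') :
    F ∈ LinearMap.range (expand r) := by
  let c : (Fin r → YoungDiagram) →₀ ℚ :=
    Finsupp.onFinset (finite_sum_card_le (Fin r) N).toFinset (fun μ => F.coeff (multiRowExponent μ))
      fun μ hμ => by
        rw [Set.Finite.mem_toFinset, Set.mem_ofPred_eq, ← degree_multiRowExponent]
        exact hdeg _ hμ
  refine ⟨(multiMonomialBasis r).repr.symm c, ?_⟩
  ext d
  rw [coeff_expand, LinearEquiv.apply_symm_apply, Finsupp.onFinset_apply]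
  exact hsymm _ _ fun i => by
    rw [multiRowExponent, curry_ofBlocks, exponents_rowExponent_shape]

end Expansion

/-! ### Multi-symmetric Schur functions -/

section Stable

variable {r : ℕ} {lam : Fin r → YoungDiagram} {d d' : Fin r × ℕ →₀ ℕ} {l l' : Fin r → List ℕ}

/-- The lists `l i` are large enough for the variables `x_{i,j}` with `j` in `l i` to determine the
coefficient of the monomial `d` in the multi-symmetric Schur function of `lam`. -/
structure IsStable (lam : Fin r → YoungDiagram) (d : Fin r × ℕ →₀ ℕ) (l : Fin r → List ℕ) :
    Prop where
  nodup : ∀ i, (l i).Nodup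
  colLen_le_length : ∀ i, (lam i).colLen 0 ≤ (l i).length
  mem_of_ne_zero : ∀ i j, d (i, j) ≠ 0 → j ∈ l i

theorem IsStable.coeff_eq_of_subset (h : IsStable lam d l) (hl' : ∀ i, (l' i).Nodup)
    (hsub : ∀ i, l i ⊆ l' i) :
    (blockSchurPoly lam fun i => (l' i).map (Prod.mk i)).coeff d =
      (blockSchurPoly lam fun i => (l i).map (Prod.mk i)).coeff d := by
  refine coeff_blockSchurPoly_of_subset (fun i => (h.nodup i).map (Prod.mk_right_injective i))
    (fun i => (hl' i).map (Prod.mk_right_injective i)) (fun i => List.map_subset _ (hsub i))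
    (fun i => by simpa only [List.length_map] using h.colLen_le_length i) fun i u hu hul => ?_
  obtain ⟨j, -, rfl⟩ := List.mem_map.1 hu
  exact by_contra fun hd => hul (List.mem_map_of_mem (h.mem_of_ne_zero i j hd))

theorem IsStable.coeff_eq (h : IsStable lam d l) (h' : IsStable lam d l') :
    (blockSchurPoly lam fun i => (l i).map (Prod.mk i)).coeff d =
      (blockSchurPoly lam fun i => (l' i).map (Prod.mk i)).coeff d := by
  have hunion (i : Fin r) : (l i ∪ l' i).Nodup := (h'.nodup i).union _
  rw [← h.coeff_eq_of_subset hunion fun i _ hj => List.mem_union_iff.2 (.inl hj),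
    ← h'.coeff_eq_of_subset hunion fun i _ hj => List.mem_union_iff.2 (.inr hj)]

theorem IsStable.map_perm (h : IsStable lam d l) {s : Fin r → Equiv.Perm ℕ}
    (hs : ∀ i j, d' (i, s i j) = d (i, j)) : IsStable lam d' fun i => (l i).map (s i) where
  nodup i := (h.nodup i).map (s i).injective
  colLen_le_length i := by simpa only [List.length_map] using h.colLen_le_length i
  mem_of_ne_zero i j hj := by
    obtain ⟨k, rfl⟩ := (s i).surjective j
    exact List.mem_map_of_mem (h.mem_of_ne_zero i k (hs i k ▸ hj))

/-- A number of variables of each kind that suffices to compute the coefficient of the monomial `d`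
in the multi-symmetric Schur function of `lam`. -/
def stableBound (lam : Fin r → YoungDiagram) (d : Fin r × ℕ →₀ ℕ) : ℕ :=
  ∑ i, (lam i).colLen 0 + d.support.sup fun x => x.2 + 1

theorem colLen_le_stableBound (lam : Fin r → YoungDiagram) (d : Fin r × ℕ →₀ ℕ) (i : Fin r) :
    (lam i).colLen 0 ≤ stableBound lam d :=
  (Finset.single_le_sum (f := fun i => (lam i).colLen 0) (fun _ _ => Nat.zero_le _)
    (Finset.mem_univ i)).trans (Nat.le_add_right _ _)

theorem lt_stableBound (lam : Fin r → YoungDiagram) {i : Fin r} {j : ℕ} (h : d (i, j) ≠ 0) :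
    j < stableBound lam d :=
  (Finset.le_sup (f := fun x : Fin r × ℕ => x.2 + 1) (Finsupp.mem_support_iff.2 h)).trans
    (Nat.le_add_left _ _)

theorem isStable_range {n : Fin r → ℕ} (hn : ∀ i, (lam i).colLen 0 ≤ n i)
    (hd : ∀ i j, d (i, j) ≠ 0 → j < n i) : IsStable lam d fun i => List.range (n i) where
  nodup _ := List.nodup_range
  colLen_le_length i := by simpa only [List.length_range] using hn i
  mem_of_ne_zero i j hj := List.mem_range.2 (hd i j hj)

theorem isStable_range_stableBound (lam : Fin r → YoungDiagram) (d : Fin r × ℕ →₀ ℕ) :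
    IsStable lam d fun _ => List.range (stableBound lam d) :=
  isStable_range (colLen_le_stableBound lam d) fun _ _ => lt_stableBound lam

/-- The limit of the multi-symmetric Schur polynomials of `lam` as a formal power series. -/
def multiSchurSeries (lam : Fin r → YoungDiagram) : MvPowerSeries (Fin r × ℕ) ℚ :=
  fun d => (multiSchurPoly lam fun _ => stableBound lam d).coeff d

theorem coeff_multiSchurSeries (lam : Fin r → YoungDiagram) (d : Fin r × ℕ →₀ ℕ) :
    (multiSchurSeries lam).coeff d = (multiSchurPoly lam fun _ => stableBound lam d).coeff d :=
  rfl

theorem IsStable.coeff_blockSchurPoly (h : IsStable lam d l) :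
    (blockSchurPoly lam fun i => (l i).map (Prod.mk i)).coeff d =
      (multiSchurSeries lam).coeff d := by
  rw [coeff_multiSchurSeries, multiSchurPoly_eq_blockSchurPoly]
  exact h.coeff_eq (isStable_range_stableBound lam d)

theorem coeff_multiSchurPoly {n : Fin r → ℕ} (hn : ∀ i, (lam i).colLen 0 ≤ n i)
    (hd : ∀ i j, d (i, j) ≠ 0 → j < n i) :
    (multiSchurPoly lam n).coeff d = (multiSchurSeries lam).coeff d := by
  rw [multiSchurPoly_eq_blockSchurPoly]
  exact (isStable_range hn hd).coeff_blockSchurPoly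

theorem degree_of_coeff_multiSchurSeries_ne_zero (h : (multiSchurSeries lam).coeff d ≠ 0) :
    d.degree = ∑ i, (lam i).card :=
  by_contra fun hne =>
    h ((isHomogeneous_multiSchurPoly (colLen_le_stableBound lam d)).coeff_eq_zero hne)

theorem coeff_multiSchurSeries_eq_of_perm {s : Fin r → Equiv.Perm ℕ}
    (hs : ∀ i j, d' (i, s i j) = d (i, j)) :
    (multiSchurSeries lam).coeff d' = (multiSchurSeries lam).coeff d := by
  let e : Equiv.Perm (Fin r × ℕ) := Equiv.prodShear (Equiv.refl _) s
  have hd' : d' = d.mapDomain e := by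
    ext ⟨i, j⟩
    obtain ⟨k, rfl⟩ := (s i).surjective j
    exact (hs i k).trans (Finsupp.mapDomain_apply e.injective d (i, k)).symm
  have h := isStable_range_stableBound lam d
  rw [← h.coeff_blockSchurPoly, ← (h.map_perm hs).coeff_blockSchurPoly, hd']
  refine Eq.trans ?_ (coeff_rename_mapDomain e e.injective _ d)
  rw [rename_blockSchurPoly]
  simp only [List.map_map]
  rfl

theorem coeff_multiSchurSeries_eq_of_exponents_eq
    (h : ∀ i, exponents (d.curry i) = exponents (d'.curry i)) :
    (multiSchurSeries lam).coeff d = (multiSchurSeries lam).coeff d' := by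
  choose s hs using fun i => exists_perm_of_exponents_eq (h i)
  exact (coeff_multiSchurSeries_eq_of_perm hs).symm

theorem multiSchurSeries_mem_range_expand (lam : Fin r → YoungDiagram) :
    multiSchurSeries lam ∈ LinearMap.range (expand r) :=
  mem_range_expand (fun _ hd => (degree_of_coeff_multiSchurSeries_ne_zero hd).le)
    fun _ _ => coeff_multiSchurSeries_eq_of_exponents_eq

/-- The multi-symmetric Schur function of an `r`-tuple of partitions. -/
def multiSchurFun (lam : Fin r → YoungDiagram) : MultiSymmFun r :=
  (multiSchurSeries_mem_range_expand lam).choose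

theorem expand_multiSchurFun (lam : Fin r → YoungDiagram) :
    expand r (multiSchurFun lam) = multiSchurSeries lam :=
  (multiSchurSeries_mem_range_expand lam).choose_spec

theorem isMultiSchurFun_multiSchurFun (lam : Fin r → YoungDiagram) :
    IsMultiSchurFun lam (multiSchurFun lam) := by
  intro d
  filter_upwards [Filter.eventually_ge_atTop fun _ => stableBound lam d] with n hn
  rw [expand_multiSchurFun]
  exact coeff_multiSchurPoly (fun i => (colLen_le_stableBound lam d i).trans (hn i))
    fun i j hj => (lt_stableBound lam hj).trans_le (hn i)

end Stable

theorem linearIndependent_multiSchurSeries (r : ℕ) :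
    LinearIndependent ℚ (multiSchurSeries (r := r)) := by
  refine linearIndependent_iff'.2 fun S c hc => ?_
  let n : Fin r → ℕ := fun i => S.sup fun lam => (lam i).colLen 0
  have hn : ∀ lam ∈ S, ∀ i, (lam i).colLen 0 ≤ n i := fun lam hlam i =>
    Finset.le_sup (f := fun lam : Fin r → YoungDiagram => (lam i).colLen 0) hlam
  refine linearIndepOn_iff'.1 (linearIndepOn_multiSchurPoly n) S c hn ?_
  ext d
  simp only [coeff_sum, coeff_smul, coeff_zero]
  by_cases hd : ∀ i j, d (i, j) ≠ 0 → j < n i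
  · have hcd := congrArg (MvPowerSeries.coeff d) hc
    rw [map_sum, map_zero] at hcd
    rw [← hcd]
    exact Finset.sum_congr rfl fun lam hlam => by rw [coeff_multiSchurPoly (hn lam hlam) hd]; rfl
  · push Not at hd
    obtain ⟨i, j, hij, hle⟩ := hd
    refine Finset.sum_eq_zero fun lam _ => ?_
    have hcoeff : (multiSchurPoly lam n).coeff d = 0 := by_contra fun h =>
      (lt_of_mem_vars_multiSchurPoly (mem_vars_iff_mem_support _ |>.2 ⟨d, mem_support_iff.2 h,
        Finsupp.mem_support_iff.2 hij⟩)).not_ge hle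
    rw [hcoeff, smul_zero]

theorem linearIndependent_multiSchurFun (r : ℕ) :
    LinearIndependent ℚ (multiSchurFun (r := r)) :=
  LinearIndependent.of_comp (expand r) <| by
    convert linearIndependent_multiSchurSeries r using 1
    exact funext expand_multiSchurFun

theorem span_range_eq_top_of_graded {K M I W : Type*} [DivisionRing K] [AddCommMonoid M]
    [Module K M] (b : Module.Basis I K M) {w : I → W} (hw : ∀ N, {i | w i = N}.Finite) {s : I → M}
    (hli : LinearIndependent K s) (hs : ∀ i j, b.repr (s i) j ≠ 0 → w j = w i) :
    Submodule.span K (Set.range s) = ⊤ := by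
  let _ : AddCommGroup M := Module.addCommMonoidToAddCommGroup K
  rw [eq_top_iff, ← b.span_eq, Submodule.span_le]
  rintro _ ⟨i, rfl⟩
  let part : Set I := {j | w j = w i}
  have : Fintype part := (hw (w i)).fintype
  let s' : part → M := fun j => s j
  let b' : part → M := fun j => b j
  have hle : Submodule.span K (Set.range s') ≤ Submodule.span K (Set.range b') := by
    rw [Submodule.span_le]
    rintro _ ⟨j, rfl⟩
    rw [show b' = b ∘ Subtype.val from rfl, Set.range_comp, Subtype.range_coe, SetLike.mem_coe,
      Module.Basis.mem_span_image]
    exact fun k hk => (hs j k (Finsupp.mem_support_iff.1 hk)).trans j.2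
  have hrank : Module.finrank K (Submodule.span K (Set.range s')) =
      Module.finrank K (Submodule.span K (Set.range b')) := by
    have hs' : LinearIndependent K s' := hli.comp _ Subtype.val_injective
    have hb' : LinearIndependent K b' := b.linearIndependent.comp _ Subtype.val_injective
    rw [finrank_span_eq_card hs', finrank_span_eq_card hb']
  have : FiniteDimensional K (Submodule.span K (Set.range b')) :=
    FiniteDimensional.span_of_finite K (Set.finite_range _)
  have hspan := Submodule.eq_of_le_of_finrank_eq hle hrank
  have hbi : b i ∈ Submodule.span K (Set.range b') := Submodule.subset_span ⟨⟨i, rfl⟩, rfl⟩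
  exact Submodule.span_mono (Set.range_comp_subset_range _ s) (hspan ▸ hbi)

theorem span_multiSchurFun (r : ℕ) : Submodule.span ℚ (Set.range (multiSchurFun (r := r))) = ⊤ := by
  have hfin (N : ℕ) : {μ : Fin r → YoungDiagram | ∑ i, (μ i).card = N}.Finite :=
    (finite_sum_card_le (Fin r) N).subset fun _ h => h.le
  have hgraded (lam μ : Fin r → YoungDiagram)
      (h : (multiMonomialBasis r).repr (multiSchurFun lam) μ ≠ 0) :
      ∑ i, (μ i).card = ∑ i, (lam i).card := by
    rw [multiMonomialBasis_repr, expand_multiSchurFun] at h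
    rw [← degree_multiRowExponent, degree_of_coeff_multiSchurSeries_ne_zero h]
  exact span_range_eq_top_of_graded (multiMonomialBasis r) hfin
    (linearIndependent_multiSchurFun r) hgraded

end MultiSymm

end

/-- Multi-symmetric functions are determined by their power series expansions, so that there is at
most one multi-symmetric Schur function for each `r`-tuple of partitions; these functions exist in
`Λ(X_1|⋯|X_r)` and form a basis of it, indexed by the `r`-tuples of partitions. -/
theorem mainTheorem11 (r : ℕ) :
    Function.Injective (MultiSymm.expand r) ∧
    ∃ b : Module.Basis (Fin r → YoungDiagram) ℚ (MultiSymm.MultiSymmFun r),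
      ∀ lam : Fin r → YoungDiagram, MultiSymm.IsMultiSchurFun lam (b lam) :=
  ⟨MultiSymm.expand_injective r,
    .mk (MultiSymm.linearIndependent_multiSchurFun r) (MultiSymm.span_multiSchurFun r).ge,
    fun lam => by
      rw [Module.Basis.mk_apply]
      exact MultiSymm.isMultiSchurFun_multiSchurFun lam⟩
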